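/- Fix $H\in(\tfrac12,1)$, put $c_H=\sqrt{\frac{2H\,\Gamma(3/2-H)}{\Gamma(H+1/2)\,\Gamma(2-2H)}}$ and, for $s,t\in[0,1]$, $$z(t,s)=\mathbf 1_{\{t\ge s\}}\,c_H\,(H-\tfrac12)\,s^{1/2-H}\int_s^t u^{H-1/2}(u-s)^{H-3/2}\,du .$$ On a probability space let, for every $n\ge1$, $\xi^n_1,\dots,\xi^n_n$ be independent random variables with $P(\xi^n_i=1)=P(\xi^n_i=-1)=\tfrac12$, and define for $t\in[0,1]$ $$B^{H,n}_t=\sum_{i=1}^{\lfloor nt\rfloor} b^n_{t,i}\,\xi^n_i,\qquad b^n_{t,i}=\sqrt n\int_{(i-1)/n}^{i/n} z\Big(\frac{\lfloor nt\rfloor}{n},u\Big)\,du .$$ For $A\subseteq\{1,\dots,n\}$ let $\Xi^n_A=\prod_{i\in A}\xi^n_i$; every random variable $X$ that is a function of $\xi^n_1,\dots,\xi^n_n$ has a unique expansion $X=\sum_A x_A\Xi^n_A$ with real $x_A$. The discrete Wick product of $X=\sum_A x_A\Xi^n_A$ and $Y=\sum_B y_B\Xi^n_B$ is $$X\diamond_n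 Y=\sum_{C}\Big(\sum_{A\cup B=C,\;A\cap B=\emptyset}x_Ay_B\Big)\Xi^n_C,$$ and $X^{\diamond_n 0}=1$, $X^{\diamond_n(k+1)}=X^{\diamond_n k}\diamond_n X$. Let $B^H=(B^H_t)_{t\in[0,1]}$ be a fractional Brownian motion with Hurst parameter $H$ (possibly on another probability space), that is, a continuous centred Gaussian process with $\mathbf E[B^H_tB^H_s]=\tfrac12(t^{2H}+s^{2H}-|t-s|^{2H})$. For a centred Gaussian variable $\Phi$ put $\exp^\diamond(\Phi)=\exp(\Phi-\tfrac12\mathbf E[\Phi^2])$. The Wick product $\diamond$ is the extension to random variables in $L^2(\sigma(B^H))$ of $\exp^\diamond(\Phi)\diamond\exp^\diamond(\Psi)=\exp^\diamond(\Phi+\Psi)$, with $\Phi,\Psi$ in the linear span of $B^H$; that is, $Z=X\diamond Y$ is the a.s. unique element of $L^2(\sigma(B^H))$, if there is one, such that $\mathbf E[Z\exp^\diamond(\Psi)]=\mathbf E[X\exp^\diamond(\Psi)]\,\mathbf E[Y\exp^\diamond(\Psi)]$ for all $\Psi$ in the linear span of $B^H$. The Wick powers are $\Phi^{\diamond0}=1$,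 $\Phi^{\diamond1}=\Phi$, $\Phi^{\diamond(k+1)}=\Phi^{\diamond k}\diamond\Phi$. **Proposition.** (i) For all $0\le s\le t\le1$, all integers $n\ge1$ and $N\ge0$ with $\lfloor ns\rfloor\ge N$, $$0\le \mathbf E[(B^{H,n}_t)^2]^N+\mathbf E[(B^{H,n}_s)^2]^N-2\,\mathbf E[B^{H,n}_tB^{H,n}_s]^N-\frac1{N!}\mathbf E\Big[\big((B^{H,n}_t)^{\diamond_nN}-(B^{H,n}_s)^{\diamond_nN}\big)^2\Big]\le 2c_H^2N^2\,t^{2H(N-1)}\,n^{-(2-2H)}$$ (for $N=0$ the upper bound is read as $0$). (ii) For all $0\le s\le t\le1$ and all integers $N\ge0$, $$\lim_{n\to\infty}\mathbf E\Big[\big((B^{H,n}_t)^{\diamond_nN}-(B^{H,n}_s)^{\diamond_nN}\big)^2\Big]=\mathbf E\Big[\big((B^{H}_t)^{\diamond N}-(B^{H}_s)^{\diamond N}\big)^2\Big].$$ -/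

import Mathlib

open MeasureTheory ProbabilityTheory Filter Topology

noncomputable section

namespace WickFBM

/-! ### The kernel of fractional Brownian motion -/

/-- The constant `c_H = √(2HΓ(3/2 - H) / (Γ(H + 1/2)Γ(2 - 2H)))`. -/
def cH (H : ℝ) : ℝ :=
  Real.sqrt (2 * H * Real.Gamma (3 / 2 - H) / (Real.Gamma (H + 1 / 2) * Real.Gamma (2 - 2 * H)))

/-- The Molchan-Golosov kernel
`z_H(t,s) = 1_{t ≥ s} c_H (H - 1/2) s^{1/2 - H} ∫_s^t u^{H - 1/2} (u - s)^{H - 3/2} du`,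
for `1/2 < H < 1` and `s, t ∈ [0,1]`. -/
def kernel (H t s : ℝ) : ℝ :=
  if s ≤ t then
    cH H * (H - 1 / 2) * s ^ (1 / 2 - H) *
      ∫ u in s..t, u ^ (H - 1 / 2) * (u - s) ^ (H - 3 / 2)
  else 0

/-! ### Symmetric Bernoulli variables and the discrete Wick product

The usual indices `1, …, n` are represented by `Fin n`: the element `i : Fin n` stands for the
index `i + 1`. -/

/-- For every `n`, the `n` real random variables `ξ n i` are independent and take the
values `1` and `-1` with probability `1/2` each. Nothing is assumed on the joint law of the rows
for different `n`. -/
structure IsBernoulliArray {Ω : Type*} [MeasurableSpace Ω] (P : Measure Ω)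
    (ξ : (n : ℕ) → Fin n → Ω → ℝ) : Prop where
  measurable : ∀ n i, Measurable (ξ n i)
  prob_one : ∀ n i, P {ω | ξ n i ω = 1} = 1 / 2
  prob_neg_one : ∀ n i, P {ω | ξ n i ω = -1} = 1 / 2
  indep : ∀ n, iIndepFun (ξ n) P

section Discrete

variable {Ω : Type*} [MeasurableSpace Ω]

/-- The Walsh function `Ξ_A = ∏_{i ∈ A} ξ_i`. -/
def walsh {n : ℕ} (ξ : Fin n → Ω → ℝ) (A : Finset (Fin n)) (ω : Ω) : ℝ :=
  ∏ i ∈ A, ξ i ω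

/-- The coefficient `x_A` of `X` in its Walsh decomposition `X = ∑_A x_A Ξ_A`; since the `Ξ_A` form
an orthonormal basis of `L²(σ(ξ_1, …, ξ_n))`, it is the inner product `E[X Ξ_A]`. -/
def walshCoeff {n : ℕ} (P : Measure Ω) (ξ : Fin n → Ω → ℝ) (X : Ω → ℝ) (A : Finset (Fin n)) : ℝ :=
  ∫ ω, X ω * walsh ξ A ω ∂P

/-- The discrete Wick product
`X ⋄ₙ Y = ∑_C (∑_{A ∪ B = C, A ∩ B = ∅} x_A y_B) Ξ_C` of `X, Y ∈ L²(σ(ξ_1, …, ξ_n))`. -/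
def discreteWick {n : ℕ} (P : Measure Ω) (ξ : Fin n → Ω → ℝ) (X Y : Ω → ℝ) (ω : Ω) : ℝ :=
  ∑ C : Finset (Fin n),
    (∑ p : Finset (Fin n) × Finset (Fin n) with p.1 ∪ p.2 = C ∧ p.1 ∩ p.2 = ∅,
      walshCoeff P ξ X p.1 * walshCoeff P ξ Y p.2) * walsh ξ C ω

/-- The discrete Wick powers: `X^{⋄ₙ 0} = 1` and `X^{⋄ₙ (k+1)} = X^{⋄ₙ k} ⋄ₙ X`. -/
def discreteWickPow {n : ℕ} (P : Measure Ω) (ξ : Fin n → Ω → ℝ) (X : Ω → ℝ) : ℕ → Ω → ℝ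
  | 0 => fun _ => 1
  | k + 1 => discreteWick P ξ (discreteWickPow P ξ X k) X

/-- The coefficient `b_{t,i}^n = √n ∫_{(i-1)/n}^{i/n} z_H(⌊nt⌋/n, s) ds`
(with the index shift of `Fin n`). -/
def bCoeff (H : ℝ) (n : ℕ) (t : ℝ) (i : Fin n) : ℝ :=
  Real.sqrt n *
    ∫ s in ((i : ℕ) : ℝ) / n..(((i : ℕ) : ℝ) + 1) / n, kernel H ((⌊(n : ℝ) * t⌋₊ : ℝ) / n) s

/-- The disturbed binary random walk `B^{H,n}_t = ∑_{i=1}^{⌊nt⌋} b_{t,i}^n ξ_i`. -/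
def disturbedWalk (H : ℝ) {n : ℕ} (ξ : Fin n → Ω → ℝ) (t : ℝ) (ω : Ω) : ℝ :=
  ∑ i : Fin n with i.val + 1 ≤ ⌊(n : ℝ) * t⌋₊, bCoeff H n t i * ξ i ω

end Discrete

/-! ### Fractional Brownian motion and the continuous Wick product -/

/-- `B` is a fractional Brownian motion on `[0,1]` with Hurst parameter `H`: a centred Gaussian
process with almost surely continuous paths and covariance `(t^{2H} + s^{2H} - |t - s|^{2H}) / 2`
(stationarity of the increments is a consequence). -/
structure IsFBM {Ω : Type*} [MeasurableSpace Ω] (P : Measure Ω) (H : ℝ)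
    (B : unitInterval → Ω → ℝ) : Prop where
  measurable : ∀ t, Measurable (B t)
  gaussian : IsGaussianProcess B P
  mean_zero : ∀ t, ∫ ω, B t ω ∂P = 0
  covariance : ∀ s t, ∫ ω, B t ω * B s ω ∂P =
    ((t : ℝ) ^ (2 * H) + (s : ℝ) ^ (2 * H) - |(t : ℝ) - s| ^ (2 * H)) / 2
  continuous_paths : ∀ᵐ ω ∂P, Continuous fun t => B t ω

section Continuous

variable {Ω T : Type*} [MeasurableSpace Ω]

/-- The Wick exponential `exp^⋄(Φ) = exp(Φ - E[|Φ|²] / 2)` of a centred Gaussian variable. -/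
def wickExp (P : Measure Ω) (Φ : Ω → ℝ) (ω : Ω) : ℝ :=
  Real.exp (Φ ω - (∫ ω', |Φ ω'| ^ 2 ∂P) / 2)

/-- `X` is a square-integrable functional of the process `B`, that is, `X ∈ L²(Ω, σ(B), P)`. -/
def IsL2Functional (P : Measure Ω) (B : T → Ω → ℝ) (X : Ω → ℝ) : Prop :=
  AEStronglyMeasurable[⨆ t, MeasurableSpace.comap (B t) inferInstance] X P ∧ MemLp X 2 P

/-- `Z` is the Wick product `X ⋄ Y`, where `X, Y, Z ∈ L²(Ω, σ(B), P)` for a centred Gaussian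
process `B`. The Wick product is the extension of
`exp^⋄(Φ) ⋄ exp^⋄(Ψ) = exp^⋄(Φ + Ψ)` from the Wick exponentials of the Gaussian variables `Φ, Ψ` in
the linear span of `B`, whose linear combinations are dense in `L²(Ω, σ(B), P)`.
It is expressed by testing with Wick exponentials (the S-transform
`(S X)(Ψ) = E[X exp^⋄(Ψ)]`, which is injective): `S (X ⋄ Y) = S X · S Y`. On Wick exponentials this
is the defining relation, because `(S exp^⋄(Φ))(Ψ) = exp(E[Φ Ψ])`. -/
def IsWickProduct (P : Measure Ω) (B : T → Ω → ℝ) (X Y Z : Ω → ℝ) : Prop :=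
  IsL2Functional P B X ∧ IsL2Functional P B Y ∧ IsL2Functional P B Z ∧
    ∀ Ψ ∈ Submodule.span ℝ (Set.range B),
      ∫ ω, Z ω * wickExp P Ψ ω ∂P =
        (∫ ω, X ω * wickExp P Ψ ω ∂P) * ∫ ω, Y ω * wickExp P Ψ ω ∂P

open Classical in
/-- The Wick product `X ⋄ Y` (a version of it: it is unique up to almost sure equality), with
value `0` if it does not exist in `L²(Ω, σ(B), P)`. -/
def wick (P : Measure Ω) (B : T → Ω → ℝ) (X Y : Ω → ℝ) : Ω → ℝ :=
  if h : ∃ Z, IsWickProduct P B X Y Z then h.choose else 0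

/-- The Wick powers: `Φ^{⋄ 0} = 1`, `Φ^{⋄ 1} = Φ` and `Φ^{⋄ (k+1)} = Φ^{⋄ k} ⋄ Φ`. -/
def wickPow (P : Measure Ω) (B : T → Ω → ℝ) (Φ : Ω → ℝ) : ℕ → Ω → ℝ
  | 0 => fun _ => 1
  | 1 => Φ
  | k + 2 => wick P B (wickPow P B Φ (k + 1)) Φ

end Continuous

end WickFBM

end

/-! Write B_t = ∑ b_i ξ_i and B_s = ∑ c_i ξ_i for the walks at two times. The Walsh functions are
orthonormal, and the N-th discrete Wick power of ∑ b_i ξ_i is N! ∑_{|C|=N} (∏_{i∈C} b_i) Ξ_C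
(`discreteWickPow_linear`). Since every N-set is the range of N! injective tuples, 1/N! times the
mean square of the difference of the Wick powers is the sum of (∏ b_{g(j)} - ∏ c_{g(j)})² over
injective N-tuples g. Over all tuples, the same sum is E[B_t²]^N + E[B_s²]^N - 2 E[B_t B_s]^N. The
defect in (i) is therefore the sum over tuples with a repeated index. It is nonnegative, and because
0 ≤ c_i ≤ b_i it is at most (N choose 2) · max b_i² · (∑ b_i²)^(N-1) (`sum_not_injective_le`). The
kernel estimates max b_i² ≤ 4 c_H² n^{-(2-2H)} (`bCoeff_sq_le`) and ∑ b_i² ≤ t^{2H}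
(`sum_bCoeff_sq_le`) give the bound.

For (ii), the defect tends to 0, so only the covariances of the walk must converge. They are
integrals of products of cell averages of the kernel, which converge by Lebesgue differentiation and
dominated convergence to ∫ z(s,x) z(t,x) dx (`tendsto_sum_bCoeff_mul_bCoeff`). A beta integral
identifies this with the covariance of fractional Brownian motion (`lintegral_kernel_mul_kernel`).

On the Gaussian side the S-transform of the k-th Hermite polynomial of Φ is Ψ ↦ E[ΦΨ]^k. Injectivity
of the S-transform then makes Wick powers Hermite polynomials (`IsCentredGaussian.wickPow_ae_eq`),
and E[Φ^{⋄N} Ψ^{⋄N}] = N! E[ΦΨ]^N. Expanding the square gives exactly the discrete limit. -/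

noncomputable section

namespace WickFBM

/-! ### Walsh expansions, discrete Wick powers and sums over tuples -/

section DiscreteChaos

variable {Ω : Type*} [MeasurableSpace Ω] {P : Measure Ω} {ξ : (n : ℕ) → Fin n → Ω → ℝ}

lemma IsBernoulliArray.ae_eq_one_or [IsProbabilityMeasure P] (hξ : IsBernoulliArray P ξ) (n : ℕ)
    (i : Fin n) : ∀ᵐ ω ∂P, ξ n i ω = 1 ∨ ξ n i ω = -1 := by
  have hm (c : ℝ) : MeasurableSet {ω | ξ n i ω = c} :=
    hξ.measurable n i (measurableSet_singleton c)
  have hd : Disjoint {ω | ξ n i ω = 1} {ω | ξ n i ω = -1} := by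
    rw [Set.disjoint_left]
    intro ω h1 h2
    change ξ n i ω = 1 at h1
    change ξ n i ω = -1 at h2
    linarith
  have h : P ({ω | ξ n i ω = 1} ∪ {ω | ξ n i ω = -1}) = 1 := by
    rw [measure_union hd (hm _), hξ.prob_one, hξ.prob_neg_one, ENNReal.add_halves]
  exact (mem_ae_iff_prob_eq_one ((hm _).union (hm _))).2 h

lemma IsBernoulliArray.integral_eq_zero [IsProbabilityMeasure P] (hξ : IsBernoulliArray P ξ) (n : ℕ)
    (i : Fin n) : ∫ ω, ξ n i ω ∂P = 0 := by
  have hm (c : ℝ) : MeasurableSet {ω | ξ n i ω = c} :=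
    hξ.measurable n i (measurableSet_singleton c)
  have h : ξ n i =ᵐ[P] fun ω => {ω | ξ n i ω = 1}.indicator (fun _ => (1 : ℝ)) ω
      - {ω | ξ n i ω = -1}.indicator (fun _ => (1 : ℝ)) ω := by
    filter_upwards [hξ.ae_eq_one_or n i] with ω hω
    rcases hω with h | h <;> norm_num [Set.indicator, h]
  rw [integral_congr_ae h, integral_sub ((integrable_const _).indicator (hm _))
    ((integrable_const _).indicator (hm _)), integral_indicator_const _ (hm _),
    integral_indicator_const _ (hm _), measureReal_def, measureReal_def, hξ.prob_one,
    hξ.prob_neg_one, sub_self]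

/-- By independence the integral factors over the coordinates. A coordinate in both sets contributes
E[ξ²] = 1, one in neither contributes 1, and one in exactly one of them contributes E[ξ] = 0. -/
lemma integral_walsh_mul_walsh [IsProbabilityMeasure P] (hξ : IsBernoulliArray P ξ) (n : ℕ)
    (A B : Finset (Fin n)) :
    ∫ ω, walsh (ξ n) A ω * walsh (ξ n) B ω ∂P = if A = B then 1 else 0 := by
  classical
  let f : Fin n → ℝ → ℝ := fun i x => (if i ∈ A then x else 1) * (if i ∈ B then x else 1)
  have hf (i : Fin n) : Measurable (f i) := by
    unfold f
    split_ifs <;> fun_prop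
  have h1 (ω : Ω) : walsh (ξ n) A ω * walsh (ξ n) B ω = ∏ i, f i (ξ n i ω) := by
    simp only [walsh, f]
    rw [Finset.prod_mul_distrib, Finset.prod_ite_mem, Finset.prod_ite_mem, Finset.univ_inter,
      Finset.univ_inter]
  have h2 (i : Fin n) : ∫ ω, f i (ξ n i ω) ∂P = if (i ∈ A ↔ i ∈ B) then 1 else 0 := by
    by_cases hA : i ∈ A <;> by_cases hB : i ∈ B
    · have : (fun ω => f i (ξ n i ω)) =ᵐ[P] fun _ => (1 : ℝ) := by
        filter_upwards [hξ.ae_eq_one_or n i] with ω hω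
        rcases hω with h | h <;> simp [f, hA, hB, h]
      rw [integral_congr_ae this]
      simp [hA, hB]
    · simp [f, hA, hB, hξ.integral_eq_zero]
    · simp [f, hA, hB, hξ.integral_eq_zero]
    · simp [f, hA, hB]
  simp_rw [h1]
  rw [(hξ.indep n).integral_fun_prod_comp (fun i => (hξ.measurable n i).aemeasurable)
    (fun i => (hf i).aestronglyMeasurable)]
  simp_rw [h2]
  split_ifs with h
  · subst h; simp
  · obtain ⟨i, hi⟩ : ∃ i, ¬ (i ∈ A ↔ i ∈ B) := by
      by_contra! hc
      exact h (Finset.ext hc)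
    exact Finset.prod_eq_zero (Finset.mem_univ i) (by simp [hi])

lemma measurable_walsh (hξ : IsBernoulliArray P ξ) (n : ℕ) (A : Finset (Fin n)) :
    Measurable (walsh (ξ n) A) :=
  Finset.measurable_fun_prod A fun i _ => hξ.measurable n i

lemma integrable_walsh_mul_walsh [IsProbabilityMeasure P] (hξ : IsBernoulliArray P ξ) (n : ℕ)
    (A B : Finset (Fin n)) : Integrable (fun ω => walsh (ξ n) A ω * walsh (ξ n) B ω) P := by
  refine Integrable.of_bound (C := 1)
    ((measurable_walsh hξ n A).mul (measurable_walsh hξ n B)).aestronglyMeasurable ?_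
  filter_upwards [ae_all_iff.2 (hξ.ae_eq_one_or n)] with ω hω
  have habs (i : Fin n) : |ξ n i ω| = 1 := by
    rcases hω i with h | h <;> simp [h]
  simp [walsh, habs]

lemma integral_walsh_sum_mul_walsh_sum [IsProbabilityMeasure P] (hξ : IsBernoulliArray P ξ) (n : ℕ)
    (c d : Finset (Fin n) → ℝ) :
    ∫ ω, (∑ A, c A * walsh (ξ n) A ω) * (∑ B, d B * walsh (ξ n) B ω) ∂P = ∑ A, c A * d A := by
  have h (ω : Ω) : (∑ A, c A * walsh (ξ n) A ω) * (∑ B, d B * walsh (ξ n) B ω) =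
      ∑ A, ∑ B, c A * d B * (walsh (ξ n) A ω * walsh (ξ n) B ω) := by
    rw [Finset.sum_mul_sum]
    refine Finset.sum_congr rfl fun A _ => Finset.sum_congr rfl fun B _ => by ring
  simp_rw [h]
  rw [integral_finsetSum _ fun A _ => integrable_finsetSum _ fun B _ =>
    (integrable_walsh_mul_walsh hξ n A B).const_mul _]
  refine Finset.sum_congr rfl fun A _ => ?_
  rw [integral_finsetSum _ fun B _ => (integrable_walsh_mul_walsh hξ n A B).const_mul _]
  simp_rw [integral_const_mul, integral_walsh_mul_walsh hξ]
  simp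

/-- Allows the Wick product, defined through inner products, to be computed from any explicit Walsh
expansion. -/
lemma walshCoeff_walsh_sum [IsProbabilityMeasure P] (hξ : IsBernoulliArray P ξ) (n : ℕ)
    (c : Finset (Fin n) → ℝ) (A : Finset (Fin n)) :
    walshCoeff P (ξ n) (fun ω => ∑ B, c B * walsh (ξ n) B ω) A = c A := by
  classical
  have := integral_walsh_sum_mul_walsh_sum hξ n c (fun B => if B = A then 1 else 0)
  simpa [walshCoeff] using this

/-- The Walsh coefficients of `∑ i, b i * ξ i`. -/
def linearCoeff {n : ℕ} (b : Fin n → ℝ) (A : Finset (Fin n)) : ℝ :=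
  if A.card = 1 then ∏ i ∈ A, b i else 0

lemma sum_linearCoeff_mul_walsh {Ω' : Type*} {n : ℕ} (x : Fin n → Ω' → ℝ)
    (b : Fin n → ℝ) (ω : Ω') :
    ∑ A, linearCoeff b A * walsh x A ω = ∑ i, b i * x i ω := by
  classical
  have h : ∀ A : Finset (Fin n), linearCoeff b A * walsh x A ω =
      if A.card = 1 then ∏ i ∈ A, b i * x i ω else 0 := fun A => by
    unfold linearCoeff walsh
    split_ifs <;> simp [Finset.prod_mul_distrib]
  simp_rw [h, ← Finset.sum_filter]
  rw [← Finset.powerset_univ, ← Finset.powersetCard_eq_filter, Finset.powersetCard_one,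
    Finset.sum_map]
  simp

/-- In the induction step the coefficient of Ξ_C collects the splittings of C into an N-set and a
singleton {i}. There are |C| = N + 1 of them, each contributing N! ∏_{i∈C} b_i. -/
lemma discreteWickPow_linear [IsProbabilityMeasure P] (hξ : IsBernoulliArray P ξ) (n : ℕ)
    (b : Fin n → ℝ) (N : ℕ) :
    discreteWickPow P (ξ n) (fun ω => ∑ i, b i * ξ n i ω) N =
      fun ω => ∑ C : Finset (Fin n),
        (if C.card = N then (N.factorial : ℝ) * ∏ i ∈ C, b i else 0) * walsh (ξ n) C ω := by
  classical
  induction N with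
  | zero =>
    funext ω
    simp [discreteWickPow, walsh]
  | succ N ih =>
    funext ω
    rw [discreteWickPow, ih, discreteWick]
    have hX : (fun ω => ∑ i, b i * ξ n i ω) =
        fun ω => ∑ A, linearCoeff b A * walsh (ξ n) A ω := by
      funext ω
      rw [sum_linearCoeff_mul_walsh]
    refine Finset.sum_congr rfl fun C _ => ?_
    rw [hX]
    simp_rw [walshCoeff_walsh_sum hξ]
    congr 1
    have h1 : ∀ p ∈ (Finset.univ : Finset (Finset (Fin n) × Finset (Fin n))).filter
        (fun p => p.1 ∪ p.2 = C ∧ p.1 ∩ p.2 = ∅),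
        (if p.1.card = N then (N.factorial : ℝ) * ∏ i ∈ p.1, b i else 0) * linearCoeff b p.2 =
          if p.2.card = 1 then
            (if C.card = N + 1 then (N.factorial : ℝ) * ∏ i ∈ C, b i else 0) else 0 := by
      rintro ⟨A, B⟩ hp
      simp only [Finset.mem_filter, Finset.mem_univ, true_and] at hp
      obtain ⟨hC, hd⟩ := hp
      have hd' : Disjoint A B := Finset.disjoint_iff_inter_eq_empty.2 hd
      unfold linearCoeff
      subst hC
      rw [Finset.card_union_of_disjoint hd', Finset.prod_union hd']
      by_cases hB : B.card = 1
      · by_cases hA : A.card = N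
        · simp [hA, hB, mul_assoc]
        · simp [hA, hB]
      · simp [hB]
    rw [Finset.sum_congr rfl h1, ← Finset.sum_filter, Finset.sum_const, Finset.filter_filter]
    -- The splittings correspond to the choice of the removed element i ∈ C.
    have h2 : ((Finset.univ : Finset (Finset (Fin n) × Finset (Fin n))).filter
        (fun p => (p.1 ∪ p.2 = C ∧ p.1 ∩ p.2 = ∅) ∧ p.2.card = 1)).card = C.card := by
      have : (Finset.univ : Finset (Finset (Fin n) × Finset (Fin n))).filter
          (fun p => (p.1 ∪ p.2 = C ∧ p.1 ∩ p.2 = ∅) ∧ p.2.card = 1) =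
          C.image (fun i => (C.erase i, {i})) := by
        ext ⟨A, B⟩
        simp only [Finset.mem_filter, Finset.mem_univ, true_and, Finset.mem_image, Prod.mk.injEq]
        constructor
        · rintro ⟨⟨hC, hd⟩, hB⟩
          obtain ⟨i, rfl⟩ := Finset.card_eq_one.1 hB
          have hi : i ∉ A := by
            intro hi
            have : i ∈ A ∩ {i} := by simp [hi]
            simp [hd] at this
          refine ⟨i, ?_, ?_, rfl⟩
          · rw [← hC]; simp
          · rw [← hC]; ext j; simp only [Finset.mem_erase, Finset.mem_union, Finset.mem_singleton]
            grind
        · rintro ⟨i, hi, rfl, rfl⟩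
          refine ⟨⟨?_, ?_⟩, by simp⟩
          · ext j; simp only [Finset.mem_erase, Finset.mem_union, Finset.mem_singleton]
            grind
          · ext j; simp
      rw [this, Finset.card_image_of_injective]
      intro i j hij
      simpa using (Prod.mk.inj hij).2
    rw [h2]
    split_ifs with hC
    · rw [hC, Nat.factorial_succ]; push_cast; simp; ring
    · simp

/-- The embeddings with range C are the bijections `Fin N ≃ C`, so there are N! of them when |C| = N
and none otherwise. -/
lemma sum_embedding_eq {ι : Type*} [Fintype ι] [DecidableEq ι] (N : ℕ) (f : Finset ι → ℝ) :
    ∑ g : Fin N ↪ ι, f (Finset.univ.map g) =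
      ∑ C : Finset ι, if C.card = N then (N.factorial : ℝ) * f C else 0 := by
  rw [← Finset.sum_fiberwise (s := Finset.univ) (g := fun g : Fin N ↪ ι => Finset.univ.map g)]
  refine Finset.sum_congr rfl fun C _ => ?_
  rw [Finset.sum_congr rfl (g := fun _ => f C)
    (fun g hg => by rw [(Finset.mem_filter.1 hg).2]), Finset.sum_const, nsmul_eq_mul]
  split_ifs with hC
  · congr 2
    have e : {g : Fin N ↪ ι // Finset.univ.map g = C} ≃ (Fin N ≃ C) :=
      { toFun := fun g => Equiv.ofBijective
          (fun j => ⟨g.1 j, (Finset.ext_iff.1 g.2 _).1 (Finset.mem_map_of_mem _ (Finset.mem_univ j))⟩) (by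
            constructor
            · intro a b hab
              simpa using hab
            · rintro ⟨x, hx⟩
              rw [← g.2] at hx
              obtain ⟨j, -, rfl⟩ := Finset.mem_map.1 hx
              exact ⟨j, rfl⟩)
        invFun := fun e => ⟨e.toEmbedding.trans (Function.Embedding.subtype _), by
          ext x
          simp only [Finset.mem_map, Finset.mem_univ, true_and, Function.Embedding.trans_apply,
            Equiv.coe_toEmbedding, Function.Embedding.subtype_apply]
          constructor
          · rintro ⟨j, rfl⟩
            exact (e j).2
          · intro hx
            exact ⟨e.symm ⟨x, hx⟩, by simp⟩⟩
        left_inv := fun g => by ext j; rfl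
        right_inv := fun e => by ext j; simp }
    rw [← Fintype.card_subtype, Fintype.card_congr e,
      Fintype.card_equiv (Fintype.equivFinOfCardEq (by simp [hC])).symm, Fintype.card_fin]
  · rw [Finset.card_eq_zero.2, Nat.cast_zero, zero_mul]
    rw [Finset.filter_eq_empty_iff]
    rintro g - rfl
    simp at hC

lemma sum_embedding_eq_sum_injective {ι : Type*} [Fintype ι] [DecidableEq ι] (N : ℕ)
    (f : (Fin N → ι) → ℝ) :
    ∑ g : Fin N ↪ ι, f g = ∑ g : Fin N → ι, if Function.Injective g then f g else 0 := by
  rw [← Finset.sum_filter, Finset.sum_subtype (p := Function.Injective) _ (by simp)]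
  exact Fintype.sum_equiv (Equiv.subtypeInjectiveEquivEmbedding _ _).symm _ _ (fun _ => rfl)

/-- The discrete Itô isometry for differences of Wick powers of linear functionals. -/
lemma integral_discreteWickPow_sub_sq [IsProbabilityMeasure P] (hξ : IsBernoulliArray P ξ) (n : ℕ)
    (b c : Fin n → ℝ) (N : ℕ) :
    ∫ ω, (discreteWickPow P (ξ n) (fun ω => ∑ i, b i * ξ n i ω) N ω
        - discreteWickPow P (ξ n) (fun ω => ∑ i, c i * ξ n i ω) N ω) ^ 2 ∂P =
      (N.factorial : ℝ) * ∑ g : Fin N → Fin n,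
        if Function.Injective g then (∏ j, b (g j) - ∏ j, c (g j)) ^ 2 else 0 := by
  rw [← sum_embedding_eq_sum_injective N (fun g => (∏ j, b (g j) - ∏ j, c (g j)) ^ 2)]
  have h := sum_embedding_eq N (fun C : Finset (Fin n) => (∏ i ∈ C, b i - ∏ i ∈ C, c i) ^ 2)
  simp only [Finset.prod_map] at h
  rw [h, discreteWickPow_linear hξ, discreteWickPow_linear hξ, Finset.mul_sum]
  -- Parseval yields (N!)² per N-set; one factor N! is absorbed in passing from N-sets to injective
  -- tuples.
  have h3 := integral_walsh_sum_mul_walsh_sum hξ n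
    (fun C => if C.card = N then (N.factorial : ℝ) * (∏ i ∈ C, b i - ∏ i ∈ C, c i) else 0)
    (fun C => if C.card = N then (N.factorial : ℝ) * (∏ i ∈ C, b i - ∏ i ∈ C, c i) else 0)
  convert h3 using 1
  · congr 1
    funext ω
    rw [← Finset.sum_sub_distrib, sq]
    congr 1 <;>
    · refine Finset.sum_congr rfl fun C _ => ?_
      split_ifs <;> ring
  · refine Finset.sum_congr rfl fun C _ => ?_
    split_ifs <;> ring

lemma sum_pow_eq_sum_prod {ι : Type*} [Fintype ι] (x : ι → ℝ) (N : ℕ) :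
    (∑ i, x i) ^ N = ∑ g : Fin N → ι, ∏ j, x (g j) := by
  classical
  have := Finset.prod_univ_sum (fun _ : Fin N => (Finset.univ : Finset ι)) (fun _ i => x i)
  simpa using this

/-- The constant counts the pairs of positions that may coincide. In the induction an entry i is
prepended to g. Either g already repeats an index, and i is free, which costs ∑ x; or i equals one
of the N + 1 entries of g, which costs at most (N + 1) M. -/
lemma sum_not_injective_le {ι : Type*} [Fintype ι] [DecidableEq ι] (x : ι → ℝ) (M : ℝ)
    (hx : ∀ i, 0 ≤ x i) (hM : ∀ i, x i ≤ M) (N : ℕ) :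
    ∑ g : Fin (N + 1) → ι, (if Function.Injective g then 0 else ∏ j, x (g j)) ≤
      (N + 1 : ℝ) * N / 2 * M * (∑ i, x i) ^ N := by
  induction N with
  | zero =>
    have h (g : Fin (0 + 1) → ι) : Function.Injective g := by
      intro a b _
      exact Subsingleton.elim (α := Fin 1) a b
    simp [h]
  | succ N ih =>
    set p := ∑ i, x i with hp
    have hp0 : 0 ≤ p := Finset.sum_nonneg fun i _ => hx i
    rw [← Fintype.sum_equiv (Fin.consEquiv fun _ : Fin (N + 1 + 1) => ι)
      (fun q => if Function.Injective (Fin.cons q.1 q.2 : Fin (N + 1 + 1) → ι) then 0 else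
        ∏ j, x ((Fin.cons q.1 q.2 : Fin (N + 1 + 1) → ι) j)) _ (fun q => rfl)]
    rw [Fintype.sum_prod_type_right]
    have key (g : Fin (N + 1) → ι) : ∑ i, (if Function.Injective
          (Fin.cons i g : Fin (N + 1 + 1) → ι) then 0 else
          ∏ j, x ((Fin.cons i g : Fin (N + 1 + 1) → ι) j)) ≤
        p * (if Function.Injective g then 0 else ∏ j, x (g j)) +
          (N + 1) * M * ∏ j, x (g j) := by
      have hg0 : 0 ≤ ∏ j, x (g j) := Finset.prod_nonneg fun j _ => hx _
      calc _ ≤ ∑ i, (x i * (if Function.Injective g then 0 else ∏ j, x (g j)) +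
            ∑ k, if i = g k then x i * ∏ j, x (g j) else 0) := by
            refine Finset.sum_le_sum fun i _ => ?_
            have hn : 0 ≤ ∑ k, if i = g k then x i * ∏ j, x (g j) else 0 :=
              Finset.sum_nonneg fun k _ => by
                split_ifs
                · exact mul_nonneg (hx i) hg0
                · rfl
            simp only [Fin.cons_injective_iff, Fin.prod_univ_succ (n := N + 1), Fin.cons_zero,
              Fin.cons_succ]
            by_cases hg : Function.Injective g
            · by_cases hi : i ∈ Set.range g
              · obtain ⟨k, rfl⟩ := hi
                simp only [Set.mem_range_self, not_true_eq_false, hg, and_true, if_false, if_true,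
                  mul_zero, zero_add]
                refine le_trans ?_ (Finset.single_le_sum (f := fun k' =>
                  if g k = g k' then x (g k) * ∏ j, x (g j) else 0) ?_ (Finset.mem_univ k))
                · simp
                · intro k' _
                  split_ifs
                  · exact mul_nonneg (hx _) hg0
                  · rfl
              · simpa [hi, hg] using hn
            · simp only [hg, and_false, if_false]
              linarith
        _ ≤ _ := by
            rw [Finset.sum_add_distrib, ← Finset.sum_mul, Finset.sum_comm]
            simp only [Finset.sum_ite_eq', Finset.mem_univ, if_true]
            refine add_le_add le_rfl ?_
            rw [← Finset.sum_mul]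
            refine mul_le_mul_of_nonneg_right ?_ hg0
            refine (Finset.sum_le_card_nsmul _ _ M fun j _ => hM _).trans ?_
            simp
    refine (Finset.sum_le_sum fun g _ => key g).trans ?_
    rw [Finset.sum_add_distrib, ← Finset.mul_sum, ← Finset.mul_sum, ← sum_pow_eq_sum_prod]
    have := mul_le_mul_of_nonneg_left ih hp0
    refine (add_le_add this le_rfl).trans (le_of_eq ?_)
    push_cast
    ring

/-- The contribution of tuples with repeated indices to the square of a difference of powers. -/
lemma power_sum_sub_injective_sum_mem_Icc {ι : Type*} [Fintype ι] [DecidableEq ι] (b c : ι → ℝ)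
    (M : ℝ) (hc : ∀ i, 0 ≤ c i) (hcb : ∀ i, c i ≤ b i) (hM : ∀ i, b i ^ 2 ≤ M) (N : ℕ) :
    (∑ i, b i ^ 2) ^ (N + 1) + (∑ i, c i ^ 2) ^ (N + 1) - 2 * (∑ i, b i * c i) ^ (N + 1)
      - (∑ g : Fin (N + 1) → ι,
        if Function.Injective g then (∏ j, b (g j) - ∏ j, c (g j)) ^ 2 else 0) ∈
      Set.Icc 0 ((N + 1 : ℝ) * N / 2 * M * (∑ i, b i ^ 2) ^ N) := by
  -- Expanding the powers over all tuples gives (∏ b - ∏ c)² per tuple, so subtracting the injective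
  -- ones leaves those with a repetition.
  have h : (∑ i, b i ^ 2) ^ (N + 1) + (∑ i, c i ^ 2) ^ (N + 1)
      - 2 * (∑ i, b i * c i) ^ (N + 1)
      - (∑ g : Fin (N + 1) → ι,
        if Function.Injective g then (∏ j, b (g j) - ∏ j, c (g j)) ^ 2 else 0) =
      ∑ g : Fin (N + 1) → ι,
        if Function.Injective g then 0 else (∏ j, b (g j) - ∏ j, c (g j)) ^ 2 := by
    rw [sum_pow_eq_sum_prod, sum_pow_eq_sum_prod, sum_pow_eq_sum_prod, Finset.mul_sum,
      ← Finset.sum_add_distrib, ← Finset.sum_sub_distrib, ← Finset.sum_sub_distrib]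
    refine Finset.sum_congr rfl fun g _ => ?_
    simp only [Finset.prod_mul_distrib, Finset.prod_pow]
    split_ifs <;> ring
  rw [h]
  constructor
  · refine Finset.sum_nonneg fun g _ => ?_
    split_ifs <;> positivity
  · refine le_trans (Finset.sum_le_sum fun g _ => ?_)
      (sum_not_injective_le (fun i => b i ^ 2) M (fun i => sq_nonneg _) hM N)
    split_ifs
    · rfl
    -- From 0 ≤ ∏ c ≤ ∏ b follows (∏ b - ∏ c)² ≤ (∏ b)².
    · have h0 : 0 ≤ ∏ j, c (g j) := Finset.prod_nonneg fun j _ => hc _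
      have h1 : ∏ j, c (g j) ≤ ∏ j, b (g j) :=
        Finset.prod_le_prod (fun j _ => hc _) fun j _ => hcb _
      rw [Finset.prod_pow]
      nlinarith

end DiscreteChaos

/-! ### Estimates for the Molchan–Golosov kernel and the beta integral -/

section Kernel

variable {H : ℝ}

/-- The derivative in `u` of the kernel `z_H(u, x)`. -/
def kernelDensity (H u x : ℝ) : ℝ :=
  if 0 < x ∧ x < u then
    cH H * (H - 1 / 2) * x ^ (1 / 2 - H) * (u ^ (H - 1 / 2) * (u - x) ^ (H - 3 / 2))
  else 0

lemma cH_nonneg (H : ℝ) : 0 ≤ cH H := Real.sqrt_nonneg _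

lemma kernelDensity_nonneg (hH : 1 / 2 < H) (u x : ℝ) : 0 ≤ kernelDensity H u x := by
  unfold kernelDensity
  split_ifs with h
  · have : 0 ≤ u - x := by linarith [h.2]
    have : 0 ≤ H - 1 / 2 := by linarith
    have : 0 ≤ u := by linarith [h.1, h.2]
    have := cH_nonneg H
    have := h.1
    positivity
  · rfl

lemma measurable_kernelDensity (H : ℝ) :
    Measurable fun p : ℝ × ℝ => kernelDensity H p.1 p.2 := by
  unfold kernelDensity
  refine Measurable.ite ?_ (by fun_prop) measurable_const
  exact (measurableSet_lt measurable_const measurable_snd).inter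
    (measurableSet_lt measurable_snd measurable_fst)

lemma intervalIntegrable_sub_rpow {r : ℝ} (hr : -1 < r) (x a b : ℝ) :
    IntervalIntegrable (fun u => (u - x) ^ r) volume a b := by
  have := (intervalIntegral.intervalIntegrable_rpow' (a := a - x) (b := b - x) hr).comp_sub_right x
  simpa using this

lemma integral_sub_rpow {r : ℝ} (hr : -1 < r) (x b : ℝ) :
    ∫ u in x..b, (u - x) ^ r = (b - x) ^ (r + 1) / (r + 1) := by
  rw [intervalIntegral.integral_comp_sub_right (fun u => u ^ r) x, integral_rpow (Or.inl hr),
    sub_self, Real.zero_rpow (by linarith), sub_zero]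

lemma intervalIntegrable_kernel_integrand (hH : 1 / 2 < H) (x t : ℝ) :
    IntervalIntegrable (fun u => u ^ (H - 1 / 2) * (u - x) ^ (H - 3 / 2)) volume x t :=
  (intervalIntegrable_sub_rpow (by linarith) x x t).continuousOn_mul
    (Real.continuous_rpow_const (by linarith)).continuousOn

lemma integrableOn_kernelDensity (hH : 1 / 2 < H) (x a b : ℝ) :
    IntegrableOn (fun u => kernelDensity H u x) (Set.Ioc a b) := by
  by_cases hx : 0 < x
  · by_cases hb : x ≤ b
    · have h1 : IntegrableOn (fun u => cH H * (H - 1 / 2) * x ^ (1 / 2 - H) *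
          (u ^ (H - 1 / 2) * (u - x) ^ (H - 3 / 2))) (Set.Ioc x b) :=
        ((intervalIntegrable_iff_integrableOn_Ioc_of_le hb).1
          (intervalIntegrable_kernel_integrand hH x b)).const_mul _
      have h2 := (integrable_indicator_iff measurableSet_Ioc).2 h1
      refine (h2.integrableOn (s := Set.Ioc a b)).congr_fun ?_ measurableSet_Ioc
      intro u hu
      simp only [Set.indicator, Set.mem_Ioc, kernelDensity, hx, true_and, hu.2, and_true]
    · refine (integrableOn_zero (ε' := ℝ)).congr_fun ?_ measurableSet_Ioc
      intro u hu
      have : ¬ (x < u) := by have := hu.2; linarith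
      simp [kernelDensity, this]
  · refine (integrableOn_zero (ε' := ℝ)).congr_fun ?_ measurableSet_Ioc
    intro u hu
    simp [kernelDensity, hx]

/-- The constraint x < u moves into the integrand, so the range of integration no longer depends on
x. Increments in t become integrals over (s, t], and Tonelli's theorem applies to products of
kernels. -/
lemma kernel_eq_setIntegral {x t : ℝ} (hx : 0 < x) :
    kernel H t x = ∫ u in Set.Ioc 0 t, kernelDensity H u x := by
  unfold kernel
  split_ifs with h
  · rw [intervalIntegral.integral_of_le h, ← integral_const_mul,
      ← integral_indicator measurableSet_Ioc, ← integral_indicator measurableSet_Ioc]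
    congr 1
    funext u
    simp only [Set.indicator, Set.mem_Ioc, kernelDensity, hx, true_and]
    by_cases h1 : x < u
    · have : 0 < u := by linarith
      simp [h1, this]
    · simp [h1]
  · rw [eq_comm, setIntegral_eq_zero_of_forall_eq_zero]
    intro u hu
    have : ¬ (x < u) := by have := hu.2; linarith
    simp [kernelDensity, this]

lemma ofReal_kernel (hH : 1 / 2 < H) {x t : ℝ} (hx : 0 < x) :
    ENNReal.ofReal (kernel H t x) =
      ∫⁻ u in Set.Ioc 0 t, ENNReal.ofReal (kernelDensity H u x) := by
  rw [kernel_eq_setIntegral hx, ofReal_integral_eq_lintegral_ofReal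
    (integrableOn_kernelDensity hH x 0 t)
    (Eventually.of_forall fun u => kernelDensity_nonneg hH u x)]

lemma kernel_nonneg (hH : 1 / 2 < H) {x : ℝ} (hx : 0 < x) (t : ℝ) : 0 ≤ kernel H t x := by
  rw [kernel_eq_setIntegral hx]
  exact integral_nonneg fun u => kernelDensity_nonneg hH u x

lemma kernel_sub_kernel (hH : 1 / 2 < H) {x s t : ℝ} (hx : 0 < x) (hs : 0 ≤ s) (hst : s ≤ t) :
    kernel H t x - kernel H s x = ∫ u in Set.Ioc s t, kernelDensity H u x := by
  rw [kernel_eq_setIntegral hx, kernel_eq_setIntegral hx, ← Set.Ioc_union_Ioc_eq_Ioc hs hst,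
    setIntegral_union (Set.Ioc_disjoint_Ioc_of_le le_rfl) measurableSet_Ioc
      (integrableOn_kernelDensity hH x 0 s) (integrableOn_kernelDensity hH x s t)]
  ring

lemma kernel_mono (hH : 1 / 2 < H) {x s t : ℝ} (hx : 0 < x) (hs : 0 ≤ s) (hst : s ≤ t) :
    kernel H s x ≤ kernel H t x := by
  rw [← sub_nonneg, kernel_sub_kernel hH hx hs hst]
  exact integral_nonneg fun u => kernelDensity_nonneg hH u x

lemma kernel_of_lt {t x : ℝ} (h : t < x) : kernel H t x = 0 := by
  simp [kernel, not_le.2 h]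

/-- Serves twice: with s = 0 it dominates the kernel, and with s the grid point below t it controls
the discretization in time. Bounding u^{H-1/2} by 1 leaves a power that integrates exactly, which
cancels the factor H - 1/2. -/
lemma kernel_sub_kernel_le (hH : 1 / 2 < H) (hH' : H < 1) {x s t : ℝ} (hx : 0 < x) (hs : 0 ≤ s)
    (hst : s ≤ t) (ht : t ≤ 1) :
    kernel H t x - kernel H s x ≤ cH H * x ^ (1 / 2 - H) * (t - s) ^ (H - 1 / 2) := by
  have hc := cH_nonneg H
  have hxr : 0 ≤ x ^ (1 / 2 - H) := Real.rpow_nonneg hx.le _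
  have hst0 : 0 ≤ t - s := by linarith
  -- The density vanishes for u ≤ x, so the integral effectively starts at m; as x ≤ m and H - 3/2 <
  -- 0, the singularity may be moved from x to m.
  set m := max s x with hm
  rcases le_or_gt m t with hmt | hmt
  · have hsm : s ≤ m := le_max_left _ _
    have hxm : x ≤ m := le_max_right _ _
    rw [kernel_sub_kernel hH hx hs hst, ← Set.Ioc_union_Ioc_eq_Ioc hsm hmt,
      setIntegral_union (Set.Ioc_disjoint_Ioc_of_le le_rfl) measurableSet_Ioc
        (integrableOn_kernelDensity hH x s m) (integrableOn_kernelDensity hH x m t),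
      setIntegral_eq_zero_of_forall_eq_zero, zero_add]
    · have hfint : IntegrableOn (fun u => cH H * (H - 1 / 2) * x ^ (1 / 2 - H) *
          (u - m) ^ (H - 3 / 2)) (Set.Ioc m t) :=
        ((intervalIntegrable_iff_integrableOn_Ioc_of_le hmt).1
          (intervalIntegrable_sub_rpow (by linarith) m m t)).const_mul _
      calc _ ≤ ∫ u in Set.Ioc m t, cH H * (H - 1 / 2) * x ^ (1 / 2 - H) *
            (u - m) ^ (H - 3 / 2) := by
            refine setIntegral_mono_on (integrableOn_kernelDensity hH x m t) hfint
              measurableSet_Ioc fun u hu => ?_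
            have h1 : x < u := hxm.trans_lt hu.1
            simp only [kernelDensity, hx, h1, and_self, if_true]
            have hcc : 0 ≤ cH H * (H - 1 / 2) * x ^ (1 / 2 - H) :=
              mul_nonneg (mul_nonneg hc (by linarith)) hxr
            refine mul_le_mul_of_nonneg_left ?_ hcc
            have h2 : u ^ (H - 1 / 2) ≤ 1 :=
              Real.rpow_le_one (by linarith) (hu.2.trans ht) (by linarith)
            have h3 : (u - x) ^ (H - 3 / 2) ≤ (u - m) ^ (H - 3 / 2) :=
              Real.rpow_le_rpow_of_nonpos (by linarith [hu.1]) (by linarith) (by linarith)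
            have h4 : 0 ≤ (u - x) ^ (H - 3 / 2) := Real.rpow_nonneg (by linarith) _
            nlinarith
        _ = cH H * x ^ (1 / 2 - H) * (t - m) ^ (H - 1 / 2) := by
            rw [integral_const_mul, ← intervalIntegral.integral_of_le hmt,
              integral_sub_rpow (by linarith)]
            have : H - 3 / 2 + 1 = H - 1 / 2 := by ring
            rw [this]
            have h0 : H - 1 / 2 ≠ 0 := by linarith
            generalize (t - m) ^ (H - 1 / 2) = y
            generalize x ^ (1 / 2 - H) = z
            generalize H - 1 / 2 = a at h0
            field_simp
        _ ≤ _ := by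
            refine mul_le_mul_of_nonneg_left ?_ (mul_nonneg hc hxr)
            exact Real.rpow_le_rpow (by linarith) (by linarith) (by linarith)
    · intro u hu
      have : ¬ (x < u) := by
        intro h
        rcases lt_max_iff.1 (lt_of_lt_of_le (max_lt hu.1 h) hu.2) with h' | h'
        · exact lt_irrefl _ (lt_of_lt_of_le (lt_of_lt_of_le h' le_rfl) (le_max_left s x))
        · exact lt_irrefl _ (h'.trans_le (le_max_right s x))
      simp [kernelDensity, this]
  · have hxt : t < x := by
      rcases lt_max_iff.1 hmt with h | h
      · linarith
      · exact h
    rw [kernel_of_lt hxt, kernel_of_lt (hst.trans_lt hxt), sub_zero]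
    positivity

lemma kernel_le (hH : 1 / 2 < H) (hH' : H < 1) {x t : ℝ} (hx : 0 < x) (ht0 : 0 ≤ t)
    (ht : t ≤ 1) : kernel H t x ≤ cH H * x ^ (1 / 2 - H) := by
  have h := kernel_sub_kernel_le hH hH' hx le_rfl ht0 ht
  rw [kernel_of_lt hx, sub_zero, sub_zero] at h
  refine h.trans ?_
  have h1 : t ^ (H - 1 / 2) ≤ 1 := Real.rpow_le_one ht0 ht (by linarith)
  have h2 : 0 ≤ cH H * x ^ (1 / 2 - H) := mul_nonneg (cH_nonneg H) (Real.rpow_nonneg hx.le _)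
  nlinarith

lemma aestronglyMeasurable_kernel (H t : ℝ) :
    AEStronglyMeasurable (kernel H t) (volume.restrict (Set.Ioi 0)) := by
  have h1 : StronglyMeasurable fun x => ∫ u in Set.Ioc 0 t, kernelDensity H u x :=
    StronglyMeasurable.integral_prod_right (f := fun x u => kernelDensity H u x)
      ((measurable_kernelDensity H).comp measurable_swap).stronglyMeasurable
  refine h1.aestronglyMeasurable.congr ?_
  filter_upwards [ae_restrict_mem measurableSet_Ioi] with x hx
  rw [kernel_eq_setIntegral hx]

/-- The power bookkeeping for the change of variables in `lintegral_kernelDensity_mul`, with a = x,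
b = w - v, c = v, d = w - x, e = v - x, f = w. As an identity between monomials it holds for
independent positive variables, by taking logarithms. -/
lemma rpow_substitution {a b c d e f : ℝ} (H : ℝ) (ha : 0 < a) (hb : 0 < b) (hc : 0 < c)
    (hd : 0 < d) (he : 0 < e) (hf : 0 < f) :
    a ^ (1 - 2 * H) * (c ^ (H - 1 / 2) * f ^ (H - 1 / 2)) * e ^ (H - 3 / 2) * d ^ (H - 3 / 2) =
      b ^ (2 * H - 2) * (b * f / (c * d ^ 2)) * (a * b / (c * d)) ^ (1 - 2 * H) *
        (f * e / (c * d)) ^ (H - 3 / 2) := by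
  have h1 : b * f / (c * d ^ 2) = Real.exp (Real.log b + Real.log f - Real.log c
      - 2 * Real.log d) := by
    rw [Real.exp_sub, Real.exp_sub, Real.exp_add, Real.exp_log hb, Real.exp_log hf,
      Real.exp_log hc, two_mul, Real.exp_add, Real.exp_log hd]
    field_simp
  have h2 : Real.log (a * b / (c * d)) = Real.log a + Real.log b - Real.log c - Real.log d := by
    rw [Real.log_div (by positivity) (by positivity), Real.log_mul ha.ne' hb.ne',
      Real.log_mul hc.ne' hd.ne']
    ring
  have h3 : Real.log (f * e / (c * d)) = Real.log f + Real.log e - Real.log c - Real.log d := by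
    rw [Real.log_div (by positivity) (by positivity), Real.log_mul hf.ne' he.ne',
      Real.log_mul hc.ne' hd.ne']
    ring
  rw [h1, Real.rpow_def_of_pos ha, Real.rpow_def_of_pos hb, Real.rpow_def_of_pos hc,
    Real.rpow_def_of_pos hd, Real.rpow_def_of_pos he, Real.rpow_def_of_pos hf,
    Real.rpow_def_of_pos (by positivity), Real.rpow_def_of_pos (by positivity), h2, h3]
  simp only [← Real.exp_add]
  congr 1
  ring

lemma lintegral_rpow_mul_one_sub_rpow {α β : ℝ} (hα : 0 < α) (hβ : 0 < β) :
    ∫⁻ q in Set.Ioo (0 : ℝ) 1, ENNReal.ofReal (q ^ (α - 1) * (1 - q) ^ (β - 1)) =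
      ENNReal.ofReal (beta α β) := by
  have h := lintegral_betaPDF_eq_one hα hβ
  rw [lintegral_betaPDF] at h
  have hb := beta_pos hα hβ
  have h1 : ∀ q : ℝ, ENNReal.ofReal (1 / beta α β * q ^ (α - 1) * (1 - q) ^ (β - 1)) =
      ENNReal.ofReal (1 / beta α β) * ENNReal.ofReal (q ^ (α - 1) * (1 - q) ^ (β - 1)) := by
    intro q
    rw [mul_assoc, ENNReal.ofReal_mul (by positivity)]
  simp_rw [h1] at h
  rw [lintegral_const_mul' _ _ ENNReal.ofReal_ne_top] at h
  have h2 : ENNReal.ofReal (beta α β) * ENNReal.ofReal (1 / beta α β) = 1 := by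
    rw [← ENNReal.ofReal_mul hb.le, mul_one_div_cancel hb.ne', ENNReal.ofReal_one]
  calc _ = (ENNReal.ofReal (beta α β) * ENNReal.ofReal (1 / beta α β)) * _ := by rw [h2, one_mul]
    _ = _ := by rw [mul_assoc, h, mul_one]

/-- This is what c_H is chosen for: the beta integral is normalized to H(2H - 1), the constant in
the mixed second derivative of the covariance. The gamma factors cancel after Γ(H + 1/2) = (H - 1/2)
Γ(H - 1/2). -/
lemma cH_sq_mul_beta (hH : 1 / 2 < H) (hH' : H < 1) :
    (cH H * (H - 1 / 2)) ^ 2 * beta (2 - 2 * H) (H - 1 / 2) = H * (2 * H - 1) := by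
  have h1 := Real.Gamma_pos_of_pos (s := 3 / 2 - H) (by linarith)
  have h2 := Real.Gamma_pos_of_pos (s := H - 1 / 2) (by linarith)
  have h3 := Real.Gamma_pos_of_pos (s := 2 - 2 * H) (by linarith)
  have h4 : Real.Gamma (H + 1 / 2) = (H - 1 / 2) * Real.Gamma (H - 1 / 2) := by
    rw [← Real.Gamma_add_one (by linarith)]
    congr 1
    ring
  have h5 : 2 - 2 * H + (H - 1 / 2) = 3 / 2 - H := by ring
  have h6 : 0 < H - 1 / 2 := by linarith
  rw [mul_pow, cH, Real.sq_sqrt (by rw [h4]; positivity), h4, beta, h5]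
  have h7 : 2 * H - 1 = 2 * (H - 1 / 2) := by ring
  rw [h7]
  generalize Real.Gamma (3 / 2 - H) = x at h1
  generalize Real.Gamma (H - 1 / 2) = y at h2
  generalize Real.Gamma (2 - 2 * H) = z at h3
  generalize H - 1 / 2 = a at h6
  field_simp

/-- Only x in (0, v) contributes. The Möbius map φ carries (0, v) onto (0, 1), with 1 - φ(x) = w(v -
x)/(v(w - x)), and turns the integral into the beta integral with parameters 2 - 2H and H - 1/2. -/
lemma lintegral_kernelDensity_mul (hH : 1 / 2 < H) (hH' : H < 1) {v w : ℝ} (hv : 0 < v)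
    (hvw : v < w) (hv1 : v ≤ 1) :
    ∫⁻ x in Set.Ioc (0 : ℝ) 1,
        ENNReal.ofReal (kernelDensity H v x) * ENNReal.ofReal (kernelDensity H w x) =
      ENNReal.ofReal (H * (2 * H - 1) * (w - v) ^ (2 * H - 2)) := by
  have hw : 0 < w := hv.trans hvw
  have hb : 0 < w - v := by linarith
  set φ : ℝ → ℝ := fun x => x * (w - v) / (v * (w - x)) with hφ
  have hφ' : ∀ x ∈ Set.Ioo 0 v,
      HasDerivWithinAt φ ((w - v) * w / (v * (w - x) ^ 2)) (Set.Ioo 0 v) x := by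
    intro x hx
    have hd : 0 < w - x := by linarith [hx.2]
    have h1 : HasDerivAt (fun x : ℝ => x * (w - v)) (1 * (w - v)) x :=
      (hasDerivAt_id x).mul_const _
    have h2 : HasDerivAt (fun x : ℝ => v * (w - x)) (v * (-1)) x :=
      ((hasDerivAt_id x).const_sub w).const_mul v
    have h3 := h1.div h2 (by positivity)
    refine (h3.congr_deriv ?_).hasDerivWithinAt
    field_simp
    ring
  have h1φ : ∀ x, x < v → 1 - φ x = w * (v - x) / (v * (w - x)) := by
    intro x hx
    have hd : 0 < w - x := by linarith
    rw [hφ]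
    field_simp
    ring
  have himg : φ '' Set.Ioo 0 v = Set.Ioo 0 1 := by
    ext q
    constructor
    · rintro ⟨x, hx, rfl⟩
      have hd : 0 < w - x := by linarith [hx.2]
      have he : 0 < v - x := by linarith [hx.2]
      have ha := hx.1
      refine ⟨by positivity, ?_⟩
      have : 0 < 1 - φ x := by rw [h1φ x hx.2]; positivity
      linarith
    · rintro ⟨hq0, hq1⟩
      have hden : 0 < w - v + q * v := by positivity
      -- The solution x of q v (w - x) = x (w - v).
      refine ⟨q * v * w / (w - v + q * v), ⟨by positivity, ?_⟩, ?_⟩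
      · rw [div_lt_iff₀ hden]
        nlinarith [mul_pos hv (mul_pos hb (sub_pos.2 hq1))]
      · have : w - q * v * w / (w - v + q * v) = w * (w - v) / (w - v + q * v) := by
          field_simp
          ring
        simp only [hφ]
        rw [this]
        field_simp
  have hinj : Set.InjOn φ (Set.Ioo 0 v) := by
    intro x hx y hy hxy
    have hd : 0 < w - x := by linarith [hx.2]
    have hd' : 0 < w - y := by linarith [hy.2]
    simp only [hφ] at hxy
    rw [div_eq_div_iff (by positivity) (by positivity)] at hxy
    have : (w - v) * v * w * (x - y) = 0 := by linear_combination hxy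
    have hne : (w - v) * v * w ≠ 0 := by positivity
    have := (mul_eq_zero.1 this).resolve_left hne
    linarith
  have hcv := lintegral_image_eq_lintegral_abs_deriv_mul measurableSet_Ioo hφ' hinj
    (fun q => ENNReal.ofReal (q ^ ((2 - 2 * H) - 1) * (1 - q) ^ ((H - 1 / 2) - 1)))
  rw [himg, lintegral_rpow_mul_one_sub_rpow (by linarith) (by linarith)] at hcv
  rw [← cH_sq_mul_beta hH hH', mul_right_comm, ENNReal.ofReal_mul' (beta_pos (by linarith)
    (by linarith)).le, hcv, ← lintegral_const_mul' _ _ ENNReal.ofReal_ne_top,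
    ← lintegral_indicator measurableSet_Ioc, ← lintegral_indicator measurableSet_Ioo]
  congr 1
  funext x
  by_cases hx : x ∈ Set.Ioo 0 v
  · have hd : 0 < w - x := by linarith [hx.2]
    have he : 0 < v - x := by linarith [hx.2]
    have hx1 : x ∈ Set.Ioc (0 : ℝ) 1 := ⟨hx.1, hx.2.le.trans hv1⟩
    rw [Set.indicator_of_mem hx, Set.indicator_of_mem hx1,
      ← ENNReal.ofReal_mul (kernelDensity_nonneg hH v x), ← ENNReal.ofReal_mul (abs_nonneg _),
      ← ENNReal.ofReal_mul (by positivity)]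
    congr 1
    have hsub := rpow_substitution H hx.1 hb hv hd he hw
    have hxx : x ^ (1 / 2 - H) * x ^ (1 / 2 - H) = x ^ (1 - 2 * H) := by
      rw [← Real.rpow_add hx.1]
      congr 1
      ring
    rw [h1φ x hx.2, abs_of_nonneg (by positivity)]
    simp only [kernelDensity, hx.1, hx.2, hx.2.trans hvw, and_self, if_true, hφ]
    rw [show 2 - 2 * H - 1 = 1 - 2 * H by ring, show H - 1 / 2 - 1 = H - 3 / 2 by ring]
    calc _ = (cH H * (H - 1 / 2)) ^ 2 * ((x ^ (1 / 2 - H) * x ^ (1 / 2 - H)) *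
          (v ^ (H - 1 / 2) * w ^ (H - 1 / 2)) * (v - x) ^ (H - 3 / 2) * (w - x) ^ (H - 3 / 2)) := by
          ring
      _ = _ := by
          rw [hxx, hsub]
          ring
  · rw [Set.indicator_of_notMem hx]
    rw [Set.indicator_apply_eq_zero]
    intro hx1
    have : ¬ (x < v) := fun h => hx ⟨hx1.1, h⟩
    simp [kernelDensity, this]

end Kernel

/-! ### The kernel reproduces the covariance of fractional Brownian motion -/

section KernelCovariance

variable {H : ℝ}

lemma lintegral_kernelDensity_mul_of_ne (hH : 1 / 2 < H) (hH' : H < 1) {v w : ℝ} (hv : 0 < v)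
    (hw : 0 < w) (hv1 : v ≤ 1) (hw1 : w ≤ 1) (hvw : v ≠ w) :
    ∫⁻ x in Set.Ioc (0 : ℝ) 1,
        ENNReal.ofReal (kernelDensity H v x) * ENNReal.ofReal (kernelDensity H w x) =
      ENNReal.ofReal (H * (2 * H - 1) * |v - w| ^ (2 * H - 2)) := by
  rcases lt_or_gt_of_ne hvw with h | h
  · rw [lintegral_kernelDensity_mul hH hH' hv h hv1, abs_sub_comm, abs_of_pos (by linarith)]
  · rw [abs_of_pos (by linarith), ← lintegral_kernelDensity_mul hH hH' hw h hw1]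
    simp_rw [mul_comm]

lemma intervalIntegrable_const_sub_rpow {r : ℝ} (hr : -1 < r) (x a b : ℝ) :
    IntervalIntegrable (fun u => (x - u) ^ r) volume a b := by
  have := (intervalIntegral.intervalIntegrable_rpow' (a := x - a) (b := x - b) hr).comp_sub_left x
  simpa using this

lemma integral_const_sub_rpow {r : ℝ} (hr : -1 < r) (x a b : ℝ) :
    ∫ u in a..b, (x - u) ^ r = ((x - a) ^ (r + 1) - (x - b) ^ (r + 1)) / (r + 1) := by
  rw [intervalIntegral.integral_comp_sub_left (fun u => u ^ r) x, integral_rpow (Or.inl hr)]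

lemma lintegral_abs_sub_rpow (hH : 1 / 2 < H) {w t : ℝ} (hw : 0 ≤ w) (hwt : w ≤ t) :
    ∫⁻ v in Set.Ioc 0 t, ENNReal.ofReal (H * (2 * H - 1) * |v - w| ^ (2 * H - 2)) =
      ENNReal.ofReal (H * (w ^ (2 * H - 1) + (t - w) ^ (2 * H - 1))) := by
  have hr : -1 < 2 * H - 2 := by linarith
  have e1 : Set.EqOn (fun v => |v - w| ^ (2 * H - 2)) (fun v => (w - v) ^ (2 * H - 2))
      (Set.uIcc 0 w) := by
    intro v hv
    rw [Set.uIcc_of_le hw] at hv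
    simp only
    rw [abs_sub_comm, abs_of_nonneg (by linarith [hv.2])]
  have e2 : Set.EqOn (fun v => |v - w| ^ (2 * H - 2)) (fun v => (v - w) ^ (2 * H - 2))
      (Set.uIcc w t) := by
    intro v hv
    rw [Set.uIcc_of_le hwt] at hv
    simp only
    rw [abs_of_nonneg (by linarith [hv.1])]
  have i1 : IntervalIntegrable (fun v => |v - w| ^ (2 * H - 2)) volume 0 w :=
    (intervalIntegrable_const_sub_rpow hr w 0 w).congr
      (fun v hv => (e1 (Set.uIoc_subset_uIcc hv)).symm)
  have i2 : IntervalIntegrable (fun v => |v - w| ^ (2 * H - 2)) volume w t :=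
    (intervalIntegrable_sub_rpow hr w w t).congr
      (fun v hv => (e2 (Set.uIoc_subset_uIcc hv)).symm)
  have i3 := (i1.trans i2).const_mul (H * (2 * H - 1))
  rw [← ofReal_integral_eq_lintegral_ofReal
    ((intervalIntegrable_iff_integrableOn_Ioc_of_le (hw.trans hwt)).1 i3)
    (Eventually.of_forall fun v => mul_nonneg (by nlinarith) (Real.rpow_nonneg (abs_nonneg _) _)),
    ← intervalIntegral.integral_of_le (hw.trans hwt), intervalIntegral.integral_const_mul,
    ← intervalIntegral.integral_add_adjacent_intervals i1 i2,
    intervalIntegral.integral_congr e1, intervalIntegral.integral_congr e2,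
    integral_sub_rpow hr, integral_const_sub_rpow hr, sub_self, sub_zero,
    show 2 * H - 2 + 1 = 2 * H - 1 by ring, Real.zero_rpow (by linarith), sub_zero]
  congr 1
  have h0 : 2 * H - 1 ≠ 0 := by linarith
  generalize w ^ (2 * H - 1) = y
  generalize (t - w) ^ (2 * H - 1) = z
  generalize 2 * H - 1 = a at h0
  field_simp

lemma lintegral_rpow_add_rpow (hH : 1 / 2 < H) {s t : ℝ} (hs : 0 ≤ s) (hst : s ≤ t) :
    ∫⁻ w in Set.Ioc 0 s, ENNReal.ofReal (H * (w ^ (2 * H - 1) + (t - w) ^ (2 * H - 1))) =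
      ENNReal.ofReal ((t ^ (2 * H) + s ^ (2 * H) - (t - s) ^ (2 * H)) / 2) := by
  have hr : -1 < 2 * H - 1 := by linarith
  have i1 : IntervalIntegrable (fun v : ℝ => v ^ (2 * H - 1)) volume 0 s :=
    intervalIntegral.intervalIntegrable_rpow' hr
  have i2 := intervalIntegrable_const_sub_rpow hr t 0 s
  have i3 := (i1.add i2).const_mul H
  rw [← ofReal_integral_eq_lintegral_ofReal
    ((intervalIntegrable_iff_integrableOn_Ioc_of_le hs).1 i3), ← intervalIntegral.integral_of_le hs,
    intervalIntegral.integral_const_mul, intervalIntegral.integral_add i1 i2,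
    integral_rpow (Or.inl hr), integral_const_sub_rpow hr, sub_zero,
    show 2 * H - 1 + 1 = 2 * H by ring, Real.zero_rpow (by linarith), sub_zero]
  · congr 1
    have : H ≠ 0 := by linarith
    field_simp
    ring
  · filter_upwards [ae_restrict_mem measurableSet_Ioc] with w hw
    have h1 : 0 ≤ w := hw.1.le
    have h2 : 0 ≤ t - w := by linarith [hw.2]
    have h3 : 0 ≤ H := by linarith
    simp only [Pi.zero_apply]
    positivity

/-- The kernel represents the covariance of fractional Brownian motion. -/
lemma lintegral_kernel_mul_kernel (hH : 1 / 2 < H) (hH' : H < 1) {s t : ℝ} (hs : 0 ≤ s)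
    (hst : s ≤ t) (ht : t ≤ 1) :
    ∫⁻ x in Set.Ioc (0 : ℝ) 1, ENNReal.ofReal (kernel H s x) * ENNReal.ofReal (kernel H t x) =
      ENNReal.ofReal ((t ^ (2 * H) + s ^ (2 * H) - (t - s) ^ (2 * H)) / 2) := by
  set κ : ℝ → ℝ → ENNReal := fun u x => ENNReal.ofReal (kernelDensity H u x) with hκ
  have hκm : Measurable (Function.uncurry κ) := (measurable_kernelDensity H).ennreal_ofReal
  have hκ1 : ∀ x, Measurable fun u => κ u x := fun x => hκm.comp (measurable_id.prodMk measurable_const)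
  have hκ2 : ∀ u, Measurable (κ u) := fun u => hκm.comp (measurable_const.prodMk measurable_id)
  calc _ = ∫⁻ x in Set.Ioc (0 : ℝ) 1, ∫⁻ w in Set.Ioc 0 s, ∫⁻ v in Set.Ioc 0 t, κ v x * κ w x := by
        refine setLIntegral_congr_fun measurableSet_Ioc fun x hx => ?_
        rw [ofReal_kernel hH hx.1, ofReal_kernel hH hx.1, ← lintegral_mul_const _ (hκ1 x)]
        congr 1
        funext w
        rw [lintegral_mul_const _ (hκ1 x), mul_comm]
    _ = ∫⁻ w in Set.Ioc 0 s, ∫⁻ x in Set.Ioc (0 : ℝ) 1, ∫⁻ v in Set.Ioc 0 t, κ v x * κ w x := by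
        refine lintegral_lintegral_swap (Measurable.aemeasurable ?_)
        have : Measurable fun p : (ℝ × ℝ) × ℝ => κ p.2 p.1.1 * κ p.1.2 p.1.1 :=
          (hκm.comp (measurable_snd.prodMk (measurable_fst.comp measurable_fst))).mul
            (hκm.comp ((measurable_snd.comp measurable_fst).prodMk
              (measurable_fst.comp measurable_fst)))
        exact this.lintegral_prod_right'
    _ = ∫⁻ w in Set.Ioc 0 s, ∫⁻ v in Set.Ioc 0 t, ∫⁻ x in Set.Ioc (0 : ℝ) 1, κ v x * κ w x := by
        congr 1
        funext w
        refine lintegral_lintegral_swap (Measurable.aemeasurable ?_)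
        exact (hκm.comp measurable_swap).mul ((hκ2 w).comp measurable_fst)
    _ = ∫⁻ w in Set.Ioc 0 s, ∫⁻ v in Set.Ioc 0 t,
          ENNReal.ofReal (H * (2 * H - 1) * |v - w| ^ (2 * H - 2)) := by
        refine setLIntegral_congr_fun measurableSet_Ioc fun w hw => ?_
        refine lintegral_congr_ae ?_
        -- The diagonal v = w must be discarded: there the inner integral may diverge, while the
        -- real power of 0 takes the default value 0. It is a null set for each w.
        filter_upwards [ae_restrict_mem measurableSet_Ioc, ae_restrict_of_ae (Measure.ae_ne volume w)]
          with v hv hvw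
        exact lintegral_kernelDensity_mul_of_ne hH hH' hv.1 hw.1 (hv.2.trans ht)
          ((hw.2.trans hst).trans ht) hvw
    _ = ∫⁻ w in Set.Ioc 0 s, ENNReal.ofReal (H * (w ^ (2 * H - 1) + (t - w) ^ (2 * H - 1))) :=
        setLIntegral_congr_fun measurableSet_Ioc fun w hw =>
          lintegral_abs_sub_rpow hH hw.1.le (hw.2.trans hst)
    _ = _ := lintegral_rpow_add_rpow hH hs hst

lemma covariance_nonneg (hH : 1 / 2 < H) {s t : ℝ} (hs : 0 ≤ s) (hst : s ≤ t) :
    0 ≤ (t ^ (2 * H) + s ^ (2 * H) - (t - s) ^ (2 * H)) / 2 := by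
  have h1 : (t - s) ^ (2 * H) ≤ t ^ (2 * H) :=
    Real.rpow_le_rpow (by linarith) (by linarith) (by linarith)
  have h2 : 0 ≤ s ^ (2 * H) := Real.rpow_nonneg hs _
  linarith

lemma aestronglyMeasurable_kernel_Ioc (H t : ℝ) :
    AEStronglyMeasurable (kernel H t) (volume.restrict (Set.Ioc 0 1)) :=
  (aestronglyMeasurable_kernel H t).mono_set Set.Ioc_subset_Ioi_self

lemma integral_kernel_mul_kernel (hH : 1 / 2 < H) (hH' : H < 1) {s t : ℝ} (hs : 0 ≤ s)
    (hst : s ≤ t) (ht : t ≤ 1) :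
    ∫ x in Set.Ioc (0 : ℝ) 1, kernel H s x * kernel H t x =
      (t ^ (2 * H) + s ^ (2 * H) - (t - s) ^ (2 * H)) / 2 := by
  rw [integral_eq_lintegral_of_nonneg_ae]
  · rw [← ENNReal.toReal_ofReal (covariance_nonneg hH hs hst),
      ← lintegral_kernel_mul_kernel hH hH' hs hst ht]
    congr 1
    refine setLIntegral_congr_fun measurableSet_Ioc fun x hx => ?_
    exact ENNReal.ofReal_mul (kernel_nonneg hH hx.1 s)
  · filter_upwards [ae_restrict_mem measurableSet_Ioc] with x hx
    exact mul_nonneg (kernel_nonneg hH hx.1 s) (kernel_nonneg hH hx.1 t)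
  · exact (aestronglyMeasurable_kernel_Ioc H s).mul (aestronglyMeasurable_kernel_Ioc H t)

lemma integrableOn_rpow_Ioc {r : ℝ} (hr : -1 < r) (a b : ℝ) :
    IntegrableOn (fun x : ℝ => x ^ r) (Set.Ioc a b) :=
  (intervalIntegral.intervalIntegrable_rpow' hr (a := a) (b := b)).1

lemma integrableOn_kernel_mul_kernel (hH : 1 / 2 < H) (hH' : H < 1) {s t : ℝ} (hs : 0 ≤ s)
    (hs1 : s ≤ 1) (ht0 : 0 ≤ t) (ht : t ≤ 1) :
    IntegrableOn (fun x => kernel H s x * kernel H t x) (Set.Ioc 0 1) := by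
  have h := (integrableOn_rpow_Ioc (r := 1 - 2 * H) (by linarith) 0 1).const_mul (cH H ^ 2)
  refine h.mono' ((aestronglyMeasurable_kernel_Ioc H s).mul (aestronglyMeasurable_kernel_Ioc H t)) ?_
  filter_upwards [ae_restrict_mem measurableSet_Ioc] with x hx
  rw [Real.norm_of_nonneg (mul_nonneg (kernel_nonneg hH hx.1 s) (kernel_nonneg hH hx.1 t))]
  have h1 := kernel_le hH hH' hx.1 hs hs1
  have h2 := kernel_le hH hH' hx.1 ht0 ht
  calc _ ≤ (cH H * x ^ (1 / 2 - H)) * (cH H * x ^ (1 / 2 - H)) :=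
        mul_le_mul h1 h2 (kernel_nonneg hH hx.1 t) ((kernel_nonneg hH hx.1 s).trans h1)
    _ = cH H ^ 2 * (x ^ (1 / 2 - H) * x ^ (1 / 2 - H)) := by ring
    _ = _ := by
        rw [← Real.rpow_add hx.1]
        congr 2
        ring

lemma integrableOn_kernel (hH : 1 / 2 < H) (hH' : H < 1) {t : ℝ}
    (ht0 : 0 ≤ t) (ht : t ≤ 1) :
    IntegrableOn (kernel H t) (Set.Ioc 0 1) := by
  have h := (integrableOn_rpow_Ioc (r := 1 / 2 - H) (by linarith) 0 1).const_mul (cH H)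
  refine h.mono' (aestronglyMeasurable_kernel_Ioc H t) ?_
  filter_upwards [ae_restrict_mem measurableSet_Ioc] with x hx
  rw [Real.norm_of_nonneg (kernel_nonneg hH hx.1 t)]
  exact kernel_le hH hH' hx.1 ht0 ht

end KernelCovariance

/-! ### Bounds and convergence for the coefficients of the walk -/

section Discretization

variable {H : ℝ}

/-- The power is taken at the right endpoint so that the bound stays finite on the cell touching 0.
The primitive has the factor 1/(3/2 - H) < 2, and a^{3/2-H} ≥ a b^{1/2-H}. -/
lemma integral_rpow_cell_le (hH : 1 / 2 < H) (hH' : H < 1) {a b : ℝ} (ha : 0 ≤ a) (hab : a < b) :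
    ∫ x in a..b, x ^ (1 / 2 - H) ≤ 2 * (b - a) * b ^ (1 / 2 - H) := by
  have hb : 0 < b := ha.trans_lt hab
  rw [integral_rpow (Or.inl (by linarith)), show 1 / 2 - H + 1 = 3 / 2 - H by ring,
    div_le_iff₀ (by linarith)]
  have h1 : a / b ≤ (a / b) ^ (3 / 2 - H) := by
    have h0 : 0 ≤ a / b := by positivity
    have h1 : a / b ≤ 1 := (div_le_one hb).2 hab.le
    rcases h0.eq_or_lt with h | h
    · rw [← h, Real.zero_rpow (by linarith)]
    · calc a / b = (a / b) ^ (1 : ℝ) := (Real.rpow_one _).symm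
        _ ≤ _ := Real.rpow_le_rpow_of_exponent_ge h h1 (by linarith)
  rw [Real.div_rpow ha hb.le] at h1
  have h2 : b ^ (3 / 2 - H) = b * b ^ (1 / 2 - H) := by
    rw [show 3 / 2 - H = 1 + (1 / 2 - H) by ring, Real.rpow_add hb, Real.rpow_one]
  have hp : 0 < b ^ (1 / 2 - H) := Real.rpow_pos_of_pos hb _
  rw [h2] at h1 ⊢
  rw [div_le_div_iff₀ hb (by positivity)] at h1
  have h3 : a * b ^ (1 / 2 - H) ≤ a ^ (3 / 2 - H) := by
    nlinarith
  have h4 : 0 ≤ (b - a) * b ^ (1 / 2 - H) := mul_nonneg (by linarith) hp.le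
  nlinarith

/-- The largest multiple of `1 / n` that does not exceed `t`. -/
def gridFloor (n : ℕ) (t : ℝ) : ℝ := (⌊(n : ℝ) * t⌋₊ : ℝ) / n

lemma gridFloor_nonneg (n : ℕ) (t : ℝ) : 0 ≤ gridFloor n t := by unfold gridFloor; positivity

lemma gridFloor_le (n : ℕ) {t : ℝ} (ht : 0 ≤ t) : gridFloor n t ≤ t := by
  unfold gridFloor
  rcases Nat.eq_zero_or_pos n with rfl | hn
  · simpa using ht
  · have hn' : (0 : ℝ) < n := by exact_mod_cast hn
    rw [div_le_iff₀ hn', mul_comm t]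
    exact Nat.floor_le (by positivity)

lemma gridFloor_mono (n : ℕ) {s t : ℝ} (hst : s ≤ t) : gridFloor n s ≤ gridFloor n t := by
  unfold gridFloor
  gcongr

lemma sub_gridFloor_le {n : ℕ} (hn : 1 ≤ n) (t : ℝ) : t - gridFloor n t ≤ 1 / n := by
  unfold gridFloor
  have hn' : (0 : ℝ) < n := by exact_mod_cast hn
  rw [sub_le_iff_le_add, ← add_div, le_div_iff₀ hn', mul_comm t]
  linarith [Nat.lt_floor_add_one ((n : ℝ) * t)]

lemma bCoeff_eq (H : ℝ) (n : ℕ) (t : ℝ) (i : Fin n) :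
    bCoeff H n t i = Real.sqrt n * ∫ s in ((i : ℕ) : ℝ) / n..(((i : ℕ) : ℝ) + 1) / n,
      kernel H (gridFloor n t) s := rfl

lemma cell_lt {n : ℕ} (hn : 1 ≤ n) (k : ℕ) : (k : ℝ) / n < ((k : ℝ) + 1) / n := by
  have hn' : (0 : ℝ) < n := by exact_mod_cast hn
  gcongr
  linarith

lemma cell_subset {n k : ℕ} (hk : k < n) :
    Set.Ioc ((k : ℝ) / n) (((k : ℝ) + 1) / n) ⊆ Set.Ioc 0 1 := by
  have hn' : (0 : ℝ) < n := by exact_mod_cast (Nat.zero_le k).trans_lt hk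
  intro x hx
  refine ⟨lt_of_le_of_lt (by positivity) hx.1, hx.2.trans ?_⟩
  rw [div_le_one hn']
  exact_mod_cast hk

lemma intervalIntegrable_cell {f : ℝ → ℝ} (hf : IntegrableOn f (Set.Ioc 0 1)) {n k : ℕ}
    (hk : k < n) : IntervalIntegrable f volume ((k : ℝ) / n) (((k : ℝ) + 1) / n) :=
  (intervalIntegrable_iff_integrableOn_Ioc_of_le (cell_lt (by omega) k).le).2
    (hf.mono_set (cell_subset hk))

lemma integral_cell_mono {f g : ℝ → ℝ} (hf : IntegrableOn f (Set.Ioc 0 1))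
    (hg : IntegrableOn g (Set.Ioc 0 1)) (hfg : ∀ x, 0 < x → f x ≤ g x) {n k : ℕ} (hk : k < n) :
    ∫ x in ((k : ℝ) / n)..(((k : ℝ) + 1) / n), f x ≤
      ∫ x in ((k : ℝ) / n)..(((k : ℝ) + 1) / n), g x := by
  have h := (cell_lt (by omega : 1 ≤ n) k).le
  rw [intervalIntegral.integral_of_le h, intervalIntegral.integral_of_le h]
  exact setIntegral_mono_on (hf.mono_set (cell_subset hk)) (hg.mono_set (cell_subset hk))
    measurableSet_Ioc fun x hx => hfg x (cell_subset hk hx).1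

lemma integrableOn_kernel_gridFloor (hH : 1 / 2 < H) (hH' : H < 1) (n : ℕ) {t : ℝ} (ht0 : 0 ≤ t)
    (ht : t ≤ 1) : IntegrableOn (kernel H (gridFloor n t)) (Set.Ioc 0 1) :=
  integrableOn_kernel hH hH' (gridFloor_nonneg n t) ((gridFloor_le n ht0).trans ht)

lemma integral_kernel_cell_nonneg (hH : 1 / 2 < H) (t : ℝ) {n k : ℕ} (hk : k < n) :
    0 ≤ ∫ x in ((k : ℝ) / n)..(((k : ℝ) + 1) / n), kernel H t x := by
  rw [intervalIntegral.integral_of_le (cell_lt (by omega : 1 ≤ n) k).le]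
  exact setIntegral_nonneg measurableSet_Ioc fun x hx => kernel_nonneg hH (cell_subset hk hx).1 t

lemma integral_kernel_cell_le (hH : 1 / 2 < H) (hH' : H < 1) {t : ℝ} (ht0 : 0 ≤ t)
    (ht : t ≤ 1) {n k : ℕ} (hk : k < n) :
    ∫ x in ((k : ℝ) / n)..(((k : ℝ) + 1) / n), kernel H t x ≤
      cH H * (2 * (1 / n) * (((k : ℝ) + 1) / n) ^ (1 / 2 - H)) := by
  have h := integral_rpow_cell_le hH hH' (a := (k : ℝ) / n) (by positivity)
    (cell_lt (by omega : 1 ≤ n) k)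
  rw [← sub_div, add_sub_cancel_left] at h
  refine le_trans ?_ (mul_le_mul_of_nonneg_left h (cH_nonneg H))
  rw [← intervalIntegral.integral_const_mul]
  exact integral_cell_mono (integrableOn_kernel hH hH' ht0 ht)
    ((integrableOn_rpow_Ioc (by linarith) 0 1).const_mul _)
    (fun x hx => kernel_le hH hH' hx ht0 ht) hk

lemma bCoeff_nonneg (hH : 1 / 2 < H) (n : ℕ) (t : ℝ) (i : Fin n) : 0 ≤ bCoeff H n t i :=
  mul_nonneg (Real.sqrt_nonneg _) (integral_kernel_cell_nonneg hH _ i.2)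

lemma bCoeff_mono (hH : 1 / 2 < H) (hH' : H < 1) (n : ℕ) {s t : ℝ} (hs : 0 ≤ s) (hst : s ≤ t)
    (ht : t ≤ 1) (i : Fin n) : bCoeff H n s i ≤ bCoeff H n t i := by
  refine mul_le_mul_of_nonneg_left ?_ (Real.sqrt_nonneg _)
  exact integral_cell_mono (integrableOn_kernel_gridFloor hH hH' n hs (hst.trans ht))
    (integrableOn_kernel_gridFloor hH hH' n (hs.trans hst) ht)
    (fun x hx => kernel_mono hH hx (gridFloor_nonneg n s) (gridFloor_mono n hst)) i.2

/-- The bound is worst for the first cell, whose right endpoint is 1/n; this gives b ≤ √n · 2 c_H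
n^{-1} n^{H-1/2} = 2 c_H n^{H-1}. -/
lemma bCoeff_sq_le (hH : 1 / 2 < H) (hH' : H < 1) (n : ℕ) {t : ℝ} (ht0 : 0 ≤ t)
    (ht : t ≤ 1) (i : Fin n) : bCoeff H n t i ^ 2 ≤ 4 * cH H ^ 2 * (n : ℝ) ^ (-(2 - 2 * H)) := by
  have hn : (0 : ℝ) < n := by exact_mod_cast (Nat.zero_le _).trans_lt i.2
  have h := integral_kernel_cell_le hH hH' (gridFloor_nonneg n t) ((gridFloor_le n ht0).trans ht) i.2
  have h0 := integral_kernel_cell_nonneg hH (gridFloor n t) i.2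
  have h1 : ((((i : ℕ) : ℝ) + 1) / n) ^ (1 / 2 - H) ≤ (1 / (n : ℝ)) ^ (1 / 2 - H) := by
    refine Real.rpow_le_rpow_of_nonpos (by positivity) ?_ (by linarith)
    gcongr
    linarith [(Nat.cast_nonneg (i : ℕ) : (0 : ℝ) ≤ _)]
  have h2 : (1 / (n : ℝ)) ^ (1 / 2 - H) = (n : ℝ) ^ (H - 1 / 2) := by
    rw [one_div, Real.inv_rpow hn.le, ← Real.rpow_neg hn.le]
    congr 1
    ring
  have hc := cH_nonneg H
  have h3 : ∫ s in ((i : ℕ) : ℝ) / n..(((i : ℕ) : ℝ) + 1) / n, kernel H (gridFloor n t) s ≤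
      cH H * (2 * (1 / n) * (n : ℝ) ^ (H - 1 / 2)) := by
    refine h.trans ?_
    rw [← h2]
    gcongr
  rw [bCoeff_eq, mul_pow, Real.sq_sqrt hn.le]
  calc _ ≤ (n : ℝ) * (cH H * (2 * (1 / n) * (n : ℝ) ^ (H - 1 / 2))) ^ 2 := by gcongr
    _ = 4 * cH H ^ 2 * ((n : ℝ) ^ (-1 : ℝ) * ((n : ℝ) ^ (H - 1 / 2) * (n : ℝ) ^ (H - 1 / 2))) := by
        rw [Real.rpow_neg_one]
        field_simp
        norm_num
    _ = _ := by
        rw [← Real.rpow_add hn, ← Real.rpow_add hn]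
        congr 2
        ring

lemma sum_integral_cells {f : ℝ → ℝ} (hf : IntegrableOn f (Set.Ioc 0 1)) {n : ℕ} (hn : 1 ≤ n) :
    ∑ i : Fin n, ∫ x in (((i : ℕ) : ℝ) / n)..((((i : ℕ) : ℝ) + 1) / n), f x =
      ∫ x in Set.Ioc (0 : ℝ) 1, f x := by
  have hn' : (n : ℝ) ≠ 0 := by positivity
  have h := intervalIntegral.sum_integral_adjacent_intervals (f := f) (μ := volume)
    (a := fun k : ℕ => (k : ℝ) / n) (n := n) (fun k hk => by
      have := intervalIntegrable_cell hf hk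
      push_cast
      exact this)
  simp only [Nat.cast_zero, zero_div, div_self hn'] at h
  rw [← intervalIntegral.integral_of_le zero_le_one, ← h, Finset.sum_range]
  push_cast
  rfl

/-- Cauchy–Schwarz on one cell, obtained from ∫ (z - m)² ≥ 0 with m the mean of z over the cell. -/
lemma bCoeff_sq_le_integral (hH : 1 / 2 < H) (hH' : H < 1) (n : ℕ) {t : ℝ} (ht0 : 0 ≤ t)
    (ht : t ≤ 1) (i : Fin n) : bCoeff H n t i ^ 2 ≤
      ∫ x in (((i : ℕ) : ℝ) / n)..((((i : ℕ) : ℝ) + 1) / n),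
        kernel H (gridFloor n t) x * kernel H (gridFloor n t) x := by
  have hn : (0 : ℝ) < n := by exact_mod_cast (Nat.zero_le _).trans_lt i.2
  set z := kernel H (gridFloor n t)
  set m := (n : ℝ) * ∫ x in (((i : ℕ) : ℝ) / n)..((((i : ℕ) : ℝ) + 1) / n), z x with hm
  have i1 := intervalIntegrable_cell (integrableOn_kernel_gridFloor hH hH' n ht0 ht) i.2
  have i2 := intervalIntegrable_cell (integrableOn_kernel_mul_kernel hH hH' (gridFloor_nonneg n t)
    ((gridFloor_le n ht0).trans ht) (gridFloor_nonneg n t) ((gridFloor_le n ht0).trans ht)) i.2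
  have h0 : 0 ≤ ∫ x in (((i : ℕ) : ℝ) / n)..((((i : ℕ) : ℝ) + 1) / n), (z x - m) ^ 2 :=
    intervalIntegral.integral_nonneg (cell_lt (Nat.one_le_of_lt i.2) i).le fun x _ => sq_nonneg _
  have h1 : ∀ x, (z x - m) ^ 2 = z x * z x - (2 * m) * z x + m ^ 2 := fun x => by ring
  simp_rw [h1] at h0
  rw [intervalIntegral.integral_add (i2.sub (i1.const_mul _)) (by simp),
    intervalIntegral.integral_sub i2 (i1.const_mul _), intervalIntegral.integral_const_mul,
    intervalIntegral.integral_const, ← sub_div, add_sub_cancel_left, smul_eq_mul] at h0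
  have h2 : ∫ x in (((i : ℕ) : ℝ) / n)..((((i : ℕ) : ℝ) + 1) / n), z x = m / n := by
    rw [hm]; field_simp
  rw [h2] at h0
  rw [bCoeff_eq, mul_pow, Real.sq_sqrt hn.le, h2]
  have h3 : (n : ℝ) * (m / n) ^ 2 = 2 * m * (m / n) - 1 / n * m ^ 2 := by
    field_simp
    ring
  linarith

lemma sum_bCoeff_sq_le (hH : 1 / 2 < H) (hH' : H < 1) {n : ℕ} (hn : 1 ≤ n) {t : ℝ} (ht0 : 0 ≤ t)
    (ht : t ≤ 1) : ∑ i : Fin n, bCoeff H n t i ^ 2 ≤ t ^ (2 * H) := by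
  have hg := (gridFloor_le n ht0).trans ht
  refine (Finset.sum_le_sum fun i _ => bCoeff_sq_le_integral hH hH' n ht0 ht i).trans ?_
  rw [sum_integral_cells (integrableOn_kernel_mul_kernel hH hH' (gridFloor_nonneg n t) hg
    (gridFloor_nonneg n t) hg) hn, integral_kernel_mul_kernel hH hH' (gridFloor_nonneg n t) le_rfl
    hg, sub_self, Real.zero_rpow (by linarith), sub_zero, add_self_div_two]
  exact Real.rpow_le_rpow (gridFloor_nonneg n t) (gridFloor_le n ht0) (by linarith)

/-- The average of `f` over the cell `(k / n, (k + 1) / n]` containing `x`. -/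
def cellAverage (f : ℝ → ℝ) (n : ℕ) (x : ℝ) : ℝ :=
  n * ∫ y in ((⌈(n : ℝ) * x⌉₊ - 1 : ℕ) : ℝ) / n..(((⌈(n : ℝ) * x⌉₊ - 1 : ℕ) : ℝ) + 1) / n, f y

lemma measurable_cellAverage (f : ℝ → ℝ) (n : ℕ) : Measurable (cellAverage f n) :=
  (measurable_from_nat (f := fun k : ℕ => (n : ℝ) * ∫ y in ((k - 1 : ℕ) : ℝ) / n..
    (((k - 1 : ℕ) : ℝ) + 1) / n, f y)).comp (Nat.measurable_ceil.comp (measurable_const_mul _))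

lemma ceil_sub_one_of_mem {n k : ℕ} (hn : 1 ≤ n) {x : ℝ}
    (hx : x ∈ Set.Ioc ((k : ℝ) / n) (((k : ℝ) + 1) / n)) : ⌈(n : ℝ) * x⌉₊ - 1 = k := by
  have hn' : (0 : ℝ) < n := by exact_mod_cast hn
  have h1 := (div_lt_iff₀ hn').1 hx.1
  have h2 := (le_div_iff₀ hn').1 hx.2
  have : ⌈(n : ℝ) * x⌉₊ = k + 1 := by
    rw [Nat.ceil_eq_iff (by omega)]
    constructor
    · simpa using by linarith
    · push_cast; linarith
  omega

/-- For x > 0 the ceiling is at least 1, so the truncated subtraction in `cellAverage` is exact and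
gives the index of the left-open cell of x. -/
lemma exists_cell {n : ℕ} (hn : 1 ≤ n) {x : ℝ} (hx : x ∈ Set.Ioc (0 : ℝ) 1) :
    ∃ k < n, x ∈ Set.Ioc ((k : ℝ) / n) (((k : ℝ) + 1) / n) ∧ ⌈(n : ℝ) * x⌉₊ - 1 = k := by
  have hn' : (0 : ℝ) < n := by exact_mod_cast hn
  have hpos : 0 < ⌈(n : ℝ) * x⌉₊ := Nat.ceil_pos.2 (mul_pos hn' hx.1)
  have hle : ⌈(n : ℝ) * x⌉₊ ≤ n := Nat.ceil_le.2 (by nlinarith [hx.2])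
  have h1 := Nat.le_ceil ((n : ℝ) * x)
  have h2 := Nat.ceil_lt_add_one (mul_pos hn' hx.1).le
  obtain ⟨k, hk⟩ : ∃ k, ⌈(n : ℝ) * x⌉₊ = k + 1 := ⟨_, (Nat.succ_pred_eq_of_pos hpos).symm⟩
  rw [hk] at h1 h2 hle
  push_cast at h1 h2
  refine ⟨k, by omega, ⟨?_, ?_⟩, by omega⟩
  · rw [div_lt_iff₀ hn']; linarith
  · rw [le_div_iff₀ hn']; linarith

/-- Rewrites the sum as an integral over a domain independent of n, ready for dominated convergence.
On each cell, of length 1/n, both averages are constant. -/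
lemma sum_bCoeff_mul_bCoeff (H : ℝ) {n : ℕ} (hn : 1 ≤ n) (s t : ℝ)
    (hfint : IntegrableOn (fun x => cellAverage (kernel H (gridFloor n s)) n x *
      cellAverage (kernel H (gridFloor n t)) n x) (Set.Ioc 0 1)) :
    ∑ i : Fin n, bCoeff H n s i * bCoeff H n t i =
      ∫ x in Set.Ioc (0 : ℝ) 1, cellAverage (kernel H (gridFloor n s)) n x *
        cellAverage (kernel H (gridFloor n t)) n x := by
  have hn' : (0 : ℝ) < n := by exact_mod_cast hn
  rw [← sum_integral_cells hfint hn]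
  refine Finset.sum_congr rfl fun i _ => ?_
  set a := ∫ y in (((i : ℕ) : ℝ) / n)..((((i : ℕ) : ℝ) + 1) / n), kernel H (gridFloor n s) y
  set b := ∫ y in (((i : ℕ) : ℝ) / n)..((((i : ℕ) : ℝ) + 1) / n), kernel H (gridFloor n t) y
  have h : ∀ x ∈ Set.Ioc (((i : ℕ) : ℝ) / n) ((((i : ℕ) : ℝ) + 1) / n),
      cellAverage (kernel H (gridFloor n s)) n x * cellAverage (kernel H (gridFloor n t)) n x =
        (n * a) * (n * b) := by
    intro x hx
    simp only [cellAverage, ceil_sub_one_of_mem hn hx, a, b]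
  rw [intervalIntegral.integral_of_le (cell_lt hn i).le, setIntegral_congr_fun measurableSet_Ioc h,
    ← intervalIntegral.integral_of_le (cell_lt hn i).le, intervalIntegral.integral_const, ← sub_div,
    add_sub_cancel_left, bCoeff_eq, bCoeff_eq, smul_eq_mul]
  have := Real.mul_self_sqrt hn'.le
  calc _ = (Real.sqrt n * Real.sqrt n) * (a * b) := by ring
    _ = _ := by
      rw [this]
      field_simp

lemma cellAverage_kernel_nonneg (hH : 1 / 2 < H) (t : ℝ) {n : ℕ} (hn : 1 ≤ n) {x : ℝ}
    (hx : x ∈ Set.Ioc (0 : ℝ) 1) : 0 ≤ cellAverage (kernel H t) n x := by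
  obtain ⟨k, hk, -, hceil⟩ := exists_cell hn hx
  rw [cellAverage, hceil]
  exact mul_nonneg (Nat.cast_nonneg n) (integral_kernel_cell_nonneg hH t hk)

lemma mul_cell_bound_le (hH : 1 / 2 < H) {n k : ℕ} (hn : 1 ≤ n) {x C : ℝ} (hC : 0 ≤ C)
    (hx0 : 0 < x) (hx : x ≤ ((k : ℝ) + 1) / n) :
    n * (C * (2 * (1 / n) * (((k : ℝ) + 1) / n) ^ (1 / 2 - H))) ≤ 2 * C * x ^ (1 / 2 - H) := by
  have hn' : (0 : ℝ) < n := by exact_mod_cast hn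
  have h := Real.rpow_le_rpow_of_nonpos hx0 hx (by linarith : 1 / 2 - H ≤ 0)
  calc _ = 2 * C * (((k : ℝ) + 1) / n) ^ (1 / 2 - H) := by field_simp
    _ ≤ _ := by gcongr

lemma cellAverage_kernel_le (hH : 1 / 2 < H) (hH' : H < 1) {t : ℝ} (ht0 : 0 ≤ t)
    (ht : t ≤ 1) {n : ℕ} (hn : 1 ≤ n) {x : ℝ} (hx : x ∈ Set.Ioc (0 : ℝ) 1) :
    cellAverage (kernel H t) n x ≤ 2 * cH H * x ^ (1 / 2 - H) := by
  obtain ⟨k, hk, hxk, hceil⟩ := exists_cell hn hx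
  rw [cellAverage, hceil]
  exact (mul_le_mul_of_nonneg_left (integral_kernel_cell_le hH hH' ht0 ht hk)
    (Nat.cast_nonneg n)).trans (mul_cell_bound_le hH hn (cH_nonneg H) hx.1 hxk.2)

/-- The averaged kernel itself varies with n through its time argument. This error tends to 0 at
each x, which leaves averages of the fixed function z(t, ·). -/
lemma cellAverage_kernel_sub_mem (hH : 1 / 2 < H) (hH' : H < 1) {t : ℝ} (ht0 : 0 ≤ t)
    (ht : t ≤ 1) {n : ℕ} (hn : 1 ≤ n) {x : ℝ} (hx : x ∈ Set.Ioc (0 : ℝ) 1) :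
    cellAverage (kernel H t) n x - cellAverage (kernel H (gridFloor n t)) n x ∈
      Set.Icc 0 (2 * (cH H * (1 / n : ℝ) ^ (H - 1 / 2)) * x ^ (1 / 2 - H)) := by
  obtain ⟨k, hk, hxk, hceil⟩ := exists_cell hn hx
  have i1 := integrableOn_kernel hH hH' ht0 ht
  have i2 := integrableOn_kernel_gridFloor hH hH' n ht0 ht
  have hn' : (0 : ℝ) < n := by exact_mod_cast hn
  have hC : 0 ≤ cH H * (1 / n : ℝ) ^ (H - 1 / 2) :=
    mul_nonneg (cH_nonneg H) (Real.rpow_nonneg (by positivity) _)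
  simp only [cellAverage, hceil]
  rw [← mul_sub, ← intervalIntegral.integral_sub (intervalIntegrable_cell i1 hk)
    (intervalIntegrable_cell i2 hk)]
  constructor
  · refine mul_nonneg hn'.le ?_
    rw [intervalIntegral.integral_of_le (cell_lt hn k).le]
    exact setIntegral_nonneg measurableSet_Ioc fun y hy => sub_nonneg.2
      (kernel_mono hH (cell_subset hk hy).1 (gridFloor_nonneg n t) (gridFloor_le n ht0))
  · refine (mul_le_mul_of_nonneg_left ?_ hn'.le).trans (mul_cell_bound_le hH hn hC hx.1 hxk.2)
    have h := integral_rpow_cell_le hH hH' (a := (k : ℝ) / n) (by positivity) (cell_lt hn k)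
    rw [← sub_div, add_sub_cancel_left] at h
    refine le_trans ?_ (mul_le_mul_of_nonneg_left h hC)
    rw [← intervalIntegral.integral_const_mul]
    refine integral_cell_mono (i1.sub i2) ((integrableOn_rpow_Ioc (by linarith) 0 1).const_mul _)
      (fun y hy => ?_) hk
    refine (kernel_sub_kernel_le hH hH' hy (gridFloor_nonneg n t) (gridFloor_le n ht0) ht).trans ?_
    have h1 : (t - gridFloor n t) ^ (H - 1 / 2) ≤ (1 / n : ℝ) ^ (H - 1 / 2) :=
      Real.rpow_le_rpow (sub_nonneg.2 (gridFloor_le n ht0)) (sub_gridFloor_le hn t) (by linarith)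
    have h2 : 0 ≤ cH H * y ^ (1 / 2 - H) := mul_nonneg (cH_nonneg H) (Real.rpow_nonneg hy.le _)
    calc _ ≤ cH H * y ^ (1 / 2 - H) * (1 / n : ℝ) ^ (H - 1 / 2) :=
          mul_le_mul_of_nonneg_left h1 h2
      _ = _ := by ring

lemma ae_tendsto_cellAverage {f : ℝ → ℝ} (hf : IntegrableOn f (Set.Ioc 0 1)) :
    ∀ᵐ x ∂(volume.restrict (Set.Ioc (0 : ℝ) 1)),
      Tendsto (fun n : ℕ => cellAverage f n x) atTop (𝓝 (f x)) := by
  have hloc : LocallyIntegrable ((Set.Ioc (0 : ℝ) 1).indicator f) volume :=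
    ((integrable_indicator_iff measurableSet_Ioc).2 hf).locallyIntegrable
  -- Cells contain x but are not centred at it, so differentiation is needed along balls with moving
  -- centres. The factor 1 asks only that x lie in the ball itself, here the closed cell of radius
  -- 1/(2n).
  have h := IsUnifLocDoublingMeasure.ae_tendsto_average volume hloc 1
  filter_upwards [ae_restrict_of_ae h, ae_restrict_mem measurableSet_Ioc] with x hx hx1
  have hlim : Tendsto (fun n : ℕ => (1 : ℝ) / (2 * n)) atTop (𝓝[>] 0) := by
    rw [tendsto_nhdsWithin_iff]
    constructor
    · have := (tendsto_one_div_atTop_nhds_zero_nat (𝕜 := ℝ)).const_mul (1 / 2)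
      rw [mul_zero] at this
      refine this.congr fun n => ?_
      rw [one_div_mul_one_div]
    · filter_upwards [eventually_ge_atTop 1] with n hn
      have hn' : (0 : ℝ) < n := by exact_mod_cast hn
      simp only [Set.mem_Ioi]
      positivity
  have hball (n k : ℕ) (hn : 1 ≤ n) : Metric.closedBall (((k : ℝ) + 1 / 2) / n) (1 / (2 * n)) =
      Set.Icc ((k : ℝ) / n) (((k : ℝ) + 1) / n) := by
    have hn' : (0 : ℝ) < n := by exact_mod_cast hn
    rw [Real.closedBall_eq_Icc]
    congr 1
    · field_simp; ring
    · field_simp; ring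
  have hx' := hx (l := atTop) (fun n : ℕ => (((⌈(n : ℝ) * x⌉₊ - 1 : ℕ) : ℝ) + 1 / 2) / n)
    (fun n : ℕ => (1 : ℝ) / (2 * n)) hlim (by
      filter_upwards [eventually_ge_atTop 1] with n hn
      obtain ⟨k, hk, hxk, hceil⟩ := exists_cell hn hx1
      rw [one_mul, hceil, hball n k hn]
      exact ⟨hxk.1.le, hxk.2⟩)
  rw [Set.indicator_of_mem hx1] at hx'
  refine hx'.congr' ?_
  filter_upwards [eventually_ge_atTop 1] with n hn
  obtain ⟨k, hk, hxk, hceil⟩ := exists_cell hn hx1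
  have hn' : (0 : ℝ) < n := by exact_mod_cast hn
  rw [cellAverage, hceil, hball n k hn, setAverage_eq, integral_Icc_eq_integral_Ioc,
    intervalIntegral.integral_of_le (cell_lt hn k).le, measureReal_def, Real.volume_Icc, ← sub_div,
    add_sub_cancel_left, ENNReal.toReal_ofReal (by positivity), one_div, inv_inv, smul_eq_mul]
  congr 1
  exact setIntegral_congr_fun measurableSet_Ioc fun y hy => Set.indicator_of_mem (cell_subset hk hy) f

lemma ae_tendsto_cellAverage_kernel (hH : 1 / 2 < H) (hH' : H < 1) {t : ℝ} (ht0 : 0 ≤ t)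
    (ht : t ≤ 1) : ∀ᵐ x ∂(volume.restrict (Set.Ioc (0 : ℝ) 1)),
      Tendsto (fun n : ℕ => cellAverage (kernel H (gridFloor n t)) n x) atTop
        (𝓝 (kernel H t x)) := by
  filter_upwards [ae_tendsto_cellAverage (integrableOn_kernel hH hH' ht0 ht),
    ae_restrict_mem measurableSet_Ioc] with x hx hx1
  have h0 : Tendsto (fun n : ℕ => 2 * (cH H * (1 / n : ℝ) ^ (H - 1 / 2)) * x ^ (1 / 2 - H)) atTop
      (𝓝 0) := by
    have h1 := (tendsto_one_div_atTop_nhds_zero_nat (𝕜 := ℝ)).rpow_const (p := H - 1 / 2)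
      (Or.inr (by linarith))
    rw [Real.zero_rpow (by linarith)] at h1
    simpa using ((h1.const_mul (cH H)).const_mul 2).mul_const (x ^ (1 / 2 - H))
  have h1 : Tendsto (fun n : ℕ => cellAverage (kernel H t) n x -
      cellAverage (kernel H (gridFloor n t)) n x) atTop (𝓝 0) := by
    refine squeeze_zero' ?_ ?_ h0
    · filter_upwards [eventually_ge_atTop 1] with n hn
      exact (cellAverage_kernel_sub_mem hH hH' ht0 ht hn hx1).1
    · filter_upwards [eventually_ge_atTop 1] with n hn
      exact (cellAverage_kernel_sub_mem hH hH' ht0 ht hn hx1).2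
  simpa using hx.sub h1

/-- The covariances of the disturbed random walk converge to those of fractional Brownian
motion. -/
lemma tendsto_sum_bCoeff_mul_bCoeff (hH : 1 / 2 < H) (hH' : H < 1) {s t : ℝ} (hs : 0 ≤ s)
    (hst : s ≤ t) (ht : t ≤ 1) :
    Tendsto (fun n : ℕ => ∑ i : Fin n, bCoeff H n s i * bCoeff H n t i) atTop
      (𝓝 ((t ^ (2 * H) + s ^ (2 * H) - (t - s) ^ (2 * H)) / 2)) := by
  have hs1 := hst.trans ht
  have ht0 := hs.trans hst
  have hg (r : ℝ) (hr : 0 ≤ r) (hr1 : r ≤ 1) (n : ℕ) : gridFloor n r ≤ 1 :=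
    (gridFloor_le n hr).trans hr1
  -- The dominating function: each average is at most 2 c_H x^{1/2-H}, and 1 - 2H > -1.
  have hbound : IntegrableOn (fun x : ℝ => 4 * cH H ^ 2 * x ^ (1 - 2 * H)) (Set.Ioc 0 1) :=
    (integrableOn_rpow_Ioc (by linarith) 0 1).const_mul _
  have hmeas (n : ℕ) : AEStronglyMeasurable (fun x => cellAverage (kernel H (gridFloor n s)) n x *
      cellAverage (kernel H (gridFloor n t)) n x) (volume.restrict (Set.Ioc (0 : ℝ) 1)) :=
    ((measurable_cellAverage _ n).mul (measurable_cellAverage _ n)).aestronglyMeasurable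
  have hle (n : ℕ) (hn : 1 ≤ n) : ∀ᵐ x ∂(volume.restrict (Set.Ioc (0 : ℝ) 1)),
      ‖cellAverage (kernel H (gridFloor n s)) n x * cellAverage (kernel H (gridFloor n t)) n x‖ ≤
        4 * cH H ^ 2 * x ^ (1 - 2 * H) := by
    filter_upwards [ae_restrict_mem measurableSet_Ioc] with x hx
    have p1 := cellAverage_kernel_nonneg hH (gridFloor n s) hn hx
    have p2 := cellAverage_kernel_nonneg hH (gridFloor n t) hn hx
    have q1 := cellAverage_kernel_le hH hH' (gridFloor_nonneg n s) (hg s hs hs1 n) hn hx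
    have q2 := cellAverage_kernel_le hH hH' (gridFloor_nonneg n t) (hg t ht0 ht n) hn hx
    rw [Real.norm_of_nonneg (mul_nonneg p1 p2)]
    calc _ ≤ (2 * cH H * x ^ (1 / 2 - H)) * (2 * cH H * x ^ (1 / 2 - H)) :=
          mul_le_mul q1 q2 p2 (p1.trans q1)
      _ = 4 * cH H ^ 2 * (x ^ (1 / 2 - H) * x ^ (1 / 2 - H)) := by ring
      _ = _ := by
          rw [← Real.rpow_add hx.1]
          congr 2
          ring
  rw [← integral_kernel_mul_kernel hH hH' hs hst ht]
  have hlim := tendsto_integral_filter_of_dominated_convergence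
    (μ := volume.restrict (Set.Ioc (0 : ℝ) 1)) (l := atTop)
    (F := fun n : ℕ => fun x => cellAverage (kernel H (gridFloor n s)) n x *
      cellAverage (kernel H (gridFloor n t)) n x) (f := fun x => kernel H s x * kernel H t x)
    (fun x => 4 * cH H ^ 2 * x ^ (1 - 2 * H)) (Eventually.of_forall hmeas)
    ((eventually_ge_atTop 1).mono hle) hbound (by
      filter_upwards [ae_tendsto_cellAverage_kernel hH hH' hs hs1,
        ae_tendsto_cellAverage_kernel hH hH' ht0 ht] with x h1 h2
      exact h1.mul h2)
  refine hlim.congr' ?_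
  filter_upwards [eventually_ge_atTop 1] with n hn
  rw [sum_bCoeff_mul_bCoeff H hn s t (hbound.mono' (hmeas n) (hle n hn))]

end Discretization

/-! ### The defect bound and the limit of the discrete second moments -/

section DisturbedWalk

variable {Ω : Type*} [MeasurableSpace Ω] {P : Measure Ω} {ξ : (n : ℕ) → Fin n → Ω → ℝ} {H : ℝ}

/-- Such a cell lies to the right of ⌊nt⌋/n, where the kernel vanishes. The walks at all times thus
become sums over the same index set. -/
lemma bCoeff_eq_zero {n : ℕ} {t : ℝ} {i : Fin n} (h : ¬ (i.val + 1 ≤ ⌊(n : ℝ) * t⌋₊)) :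
    bCoeff H n t i = 0 := by
  have hn : (0 : ℝ) < n := by exact_mod_cast (Nat.zero_le _).trans_lt i.2
  rw [bCoeff_eq, intervalIntegral.integral_of_le (cell_lt (Nat.one_le_of_lt i.2) i).le,
    setIntegral_eq_zero_of_forall_eq_zero, mul_zero]
  intro x hx
  refine kernel_of_lt (lt_of_le_of_lt ?_ hx.1)
  unfold gridFloor
  gcongr
  omega

lemma disturbedWalk_eq {Ω' : Type*} (H : ℝ) {n : ℕ} (x : Fin n → Ω' → ℝ) (t : ℝ) :
    disturbedWalk H x t = fun ω => ∑ i, bCoeff H n t i * x i ω := by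
  funext ω
  refine Finset.sum_subset (Finset.filter_subset _ _) fun i _ hi => ?_
  rw [bCoeff_eq_zero (by simpa using hi), zero_mul]

lemma integral_linear_mul_linear [IsProbabilityMeasure P] (hξ : IsBernoulliArray P ξ) (n : ℕ)
    (b c : Fin n → ℝ) :
    ∫ ω, (∑ i, b i * ξ n i ω) * (∑ i, c i * ξ n i ω) ∂P = ∑ i, b i * c i := by
  have h := integral_walsh_sum_mul_walsh_sum hξ n (linearCoeff b) (linearCoeff c)
  simp only [sum_linearCoeff_mul_walsh] at h
  rw [h]
  have h1 : ∀ A : Finset (Fin n), linearCoeff b A * linearCoeff c A =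
      if A.card = 1 then ∏ i ∈ A, b i * c i else 0 := fun A => by
    unfold linearCoeff
    split_ifs <;> simp [Finset.prod_mul_distrib]
  simp_rw [h1, ← Finset.sum_filter]
  rw [← Finset.powerset_univ, ← Finset.powersetCard_eq_filter, Finset.powersetCard_one,
    Finset.sum_map]
  simp

lemma integral_disturbedWalk_mul [IsProbabilityMeasure P] (hξ : IsBernoulliArray P ξ) (n : ℕ)
    (H s t : ℝ) : ∫ ω, disturbedWalk H (ξ n) s ω * disturbedWalk H (ξ n) t ω ∂P =
      ∑ i, bCoeff H n s i * bCoeff H n t i := by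
  simp only [disturbedWalk_eq]
  exact integral_linear_mul_linear hξ n _ _

lemma integral_disturbedWalk_sq [IsProbabilityMeasure P] (hξ : IsBernoulliArray P ξ) (n : ℕ)
    (H t : ℝ) : ∫ ω, disturbedWalk H (ξ n) t ω ^ 2 ∂P = ∑ i, bCoeff H n t i ^ 2 := by
  simp_rw [sq]
  exact integral_disturbedWalk_mul hξ n H t t

/-- The defect in the discrete isometry of Wick powers. -/
lemma wickPow_defect_mem_Icc [IsProbabilityMeasure P] (hξ : IsBernoulliArray P ξ)
    (hH : 1 / 2 < H) (hH' : H < 1) {n : ℕ} (hn : 1 ≤ n) (N : ℕ) {s t : ℝ} (hs : 0 ≤ s)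
    (hst : s ≤ t) (ht : t ≤ 1) :
    (∫ ω, (disturbedWalk H (ξ n) t ω) ^ 2 ∂P) ^ N + (∫ ω, (disturbedWalk H (ξ n) s ω) ^ 2 ∂P) ^ N
        - 2 * (∫ ω, disturbedWalk H (ξ n) t ω * disturbedWalk H (ξ n) s ω ∂P) ^ N
        - 1 / (N.factorial : ℝ) * ∫ ω, (discreteWickPow P (ξ n) (disturbedWalk H (ξ n) t) N ω
            - discreteWickPow P (ξ n) (disturbedWalk H (ξ n) s) N ω) ^ 2 ∂P
      ∈ Set.Icc 0 (2 * cH H ^ 2 * (N : ℝ) ^ 2 * t ^ (2 * H * ((N : ℝ) - 1)) *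
          (n : ℝ) ^ (-(2 - 2 * H))) := by
  cases N with
  -- The defect is 1 + 1 - 2 - 0, and the factor N² = 0 removes the power of t with exponent -2H.
  | zero => norm_num [discreteWickPow]
  | succ N =>
    have ht0 := hs.trans hst
    have h := power_sum_sub_injective_sum_mem_Icc (bCoeff H n t) (bCoeff H n s)
      (4 * cH H ^ 2 * (n : ℝ) ^ (-(2 - 2 * H))) (bCoeff_nonneg hH n s)
      (bCoeff_mono hH hH' n hs hst ht) (bCoeff_sq_le hH hH' n ht0 ht) N
    have hf : ((N + 1).factorial : ℝ) ≠ 0 := by positivity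
    rw [integral_disturbedWalk_sq hξ, integral_disturbedWalk_sq hξ, integral_disturbedWalk_mul hξ]
    simp only [disturbedWalk_eq]
    rw [integral_discreteWickPow_sub_sq hξ, ← mul_assoc, one_div_mul_cancel hf, one_mul]
    refine ⟨h.1, h.2.trans ?_⟩
    have hpow : t ^ (2 * H * (((N + 1 : ℕ) : ℝ) - 1)) = (t ^ (2 * H)) ^ N := by
      rw [Real.rpow_mul ht0]
      push_cast
      rw [add_sub_cancel_right, Real.rpow_natCast]
    rw [hpow]
    have hp : (∑ i, bCoeff H n t i ^ 2) ^ N ≤ (t ^ (2 * H)) ^ N :=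
      pow_le_pow_left₀ (Finset.sum_nonneg fun i _ => sq_nonneg _) (sum_bCoeff_sq_le hH hH' hn ht0 ht) N
    have hr : 0 ≤ (n : ℝ) ^ (-(2 - 2 * H)) := Real.rpow_nonneg (Nat.cast_nonneg n) _
    have htp : 0 ≤ (t ^ (2 * H)) ^ N := pow_nonneg (Real.rpow_nonneg ht0 _) N
    have hNN : (N : ℝ) ≤ N + 1 := by linarith
    push_cast
    -- The number of pairs (N + 1)N/2 is enlarged to (N + 1)²/2; with the factor 4 this is the
    -- constant 2(N + 1)².
    calc _ ≤ ((N : ℝ) + 1) * (N + 1) / 2 * (4 * cH H ^ 2 * (n : ℝ) ^ (-(2 - 2 * H))) *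
          (t ^ (2 * H)) ^ N := by gcongr
      _ = _ := by ring

lemma tendsto_integral_disturbedWalk_mul [IsProbabilityMeasure P] (hξ : IsBernoulliArray P ξ)
    (hH : 1 / 2 < H) (hH' : H < 1) {s t : ℝ} (hs : 0 ≤ s) (hst : s ≤ t) (ht : t ≤ 1) :
    Tendsto (fun n => ∫ ω, disturbedWalk H (ξ n) t ω * disturbedWalk H (ξ n) s ω ∂P) atTop
      (𝓝 ((t ^ (2 * H) + s ^ (2 * H) - (t - s) ^ (2 * H)) / 2)) := by
  refine (tendsto_sum_bCoeff_mul_bCoeff hH hH' hs hst ht).congr fun n => ?_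
  rw [integral_disturbedWalk_mul hξ]
  simp_rw [mul_comm]

lemma tendsto_integral_disturbedWalk_sq [IsProbabilityMeasure P] (hξ : IsBernoulliArray P ξ)
    (hH : 1 / 2 < H) (hH' : H < 1) {t : ℝ} (ht0 : 0 ≤ t) (ht : t ≤ 1) :
    Tendsto (fun n => ∫ ω, disturbedWalk H (ξ n) t ω ^ 2 ∂P) atTop (𝓝 (t ^ (2 * H))) := by
  have h := tendsto_integral_disturbedWalk_mul hξ hH hH' ht0 le_rfl ht
  rw [sub_self, Real.zero_rpow (by linarith), sub_zero, add_self_div_two] at h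
  simpa only [sq] using h

/-- The defect is squeezed to 0 because 2 - 2H > 0, so the limit is N! times the limit of the
covariance expression. -/
lemma tendsto_integral_discreteWickPow_sub_sq [IsProbabilityMeasure P]
    (hξ : IsBernoulliArray P ξ) (hH : 1 / 2 < H) (hH' : H < 1) (N : ℕ) {s t : ℝ} (hs : 0 ≤ s)
    (hst : s ≤ t) (ht : t ≤ 1) :
    Tendsto (fun n => ∫ ω, (discreteWickPow P (ξ n) (disturbedWalk H (ξ n) t) N ω
            - discreteWickPow P (ξ n) (disturbedWalk H (ξ n) s) N ω) ^ 2 ∂P) atTop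
      (𝓝 ((N.factorial : ℝ) * ((t ^ (2 * H)) ^ N + (s ^ (2 * H)) ^ N -
        2 * ((t ^ (2 * H) + s ^ (2 * H) - (t - s) ^ (2 * H)) / 2) ^ N))) := by
  have hf : (N.factorial : ℝ) ≠ 0 := by positivity
  have h1 := (((tendsto_integral_disturbedWalk_sq hξ hH hH' (hs.trans hst) ht).pow N).add
    ((tendsto_integral_disturbedWalk_sq hξ hH hH' hs (hst.trans ht)).pow N)).sub
      (((tendsto_integral_disturbedWalk_mul hξ hH hH' hs hst ht).pow N).const_mul 2)
  have h2 : Tendsto (fun n : ℕ => 2 * cH H ^ 2 * (N : ℝ) ^ 2 * t ^ (2 * H * ((N : ℝ) - 1)) *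
          (n : ℝ) ^ (-(2 - 2 * H))) atTop (𝓝 0) := by
    have := ((tendsto_rpow_neg_atTop (y := 2 - 2 * H) (by linarith)).comp
      tendsto_natCast_atTop_atTop).const_mul
        (2 * cH H ^ 2 * (N : ℝ) ^ 2 * t ^ (2 * H * ((N : ℝ) - 1)))
    rw [mul_zero] at this
    exact this
  have h3 := squeeze_zero'
    ((eventually_ge_atTop 1).mono fun n hn => (wickPow_defect_mem_Icc hξ hH hH' hn N hs hst ht).1)
    ((eventually_ge_atTop 1).mono fun n hn => (wickPow_defect_mem_Icc hξ hH hH' hn N hs hst ht).2)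
    h2
  have h4 := (h1.sub h3).const_mul (N.factorial : ℝ)
  rw [sub_zero] at h4
  refine h4.congr fun n => ?_
  field_simp
  ring

end DisturbedWalk

/-! ### Hermite polynomials under one-dimensional Gaussian laws -/

section GaussianHermite

open Polynomial in
/-- The Hermite polynomials for the centred Gaussian law of variance `v`. -/
def hermiteVar (v : ℝ) : ℕ → Polynomial ℝ
  | 0 => 1
  | k + 1 => X * hermiteVar v k - C v * derivative (hermiteVar v k)

lemma hermiteVar_succ (v : ℝ) (k : ℕ) : hermiteVar v (k + 1) =
    Polynomial.X * hermiteVar v k - Polynomial.C v * (hermiteVar v k).derivative := rfl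

lemma hermiteVar_one (v : ℝ) : hermiteVar v 1 = Polynomial.X := by
  simp [hermiteVar]

lemma derivative_hermiteVar (v : ℝ) (k : ℕ) : (hermiteVar v (k + 1)).derivative =
    Polynomial.C ((k : ℝ) + 1) * hermiteVar v k := by
  induction k with
  | zero => simp [hermiteVar]
  | succ k ih =>
    rw [hermiteVar_succ v (k + 1)]
    simp only [Polynomial.derivative_sub, Polynomial.derivative_mul, Polynomial.derivative_X,
      Polynomial.derivative_C, ih]
    rw [hermiteVar_succ v k]
    simp only [Nat.cast_add, Nat.cast_one, Polynomial.C_add, Polynomial.C_1]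
    ring

lemma integrable_pow_gaussianReal (m : ℝ) (v : NNReal) (k : ℕ) :
    Integrable (fun x => x ^ k) (gaussianReal m v) :=
  integrable_pow_of_mem_interior_integrableExpSet (X := fun x => x) (by simp) k

lemma integrable_eval_gaussianReal (m : ℝ) (v : NNReal) (p : Polynomial ℝ) :
    Integrable (fun x => p.eval x) (gaussianReal m v) := by
  induction p using Polynomial.induction_on' with
  | add p q hp hq =>
    simp only [Polynomial.eval_add]
    exact hp.add hq
  | monomial k a => simpa using (integrable_pow_gaussianReal m v k).const_mul a

lemma memLp_two_eval_gaussianReal (m : ℝ) (v : NNReal) (p : Polynomial ℝ) :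
    MemLp (fun x => p.eval x) 2 (gaussianReal m v) := by
  refine (memLp_two_iff_integrable_sq p.continuous.aestronglyMeasurable).2 ?_
  have h := integrable_eval_gaussianReal m v (p ^ 2)
  simp only [Polynomial.eval_pow] at h
  exact h

/-- The moment generating function M satisfies M' = (m + vt) M; differentiating k times and setting
t = 0 gives the recursion. No density is used, so v = 0 is covered. For k = 0 the truncated k - 1 is
harmless because of the factor k. -/
lemma integral_pow_gaussianReal_succ (m : ℝ) (v : NNReal) (k : ℕ) :
    ∫ x, x ^ (k + 1) ∂(gaussianReal m v) =
      m * ∫ x, x ^ k ∂(gaussianReal m v) + v * (k * ∫ x, x ^ (k - 1) ∂(gaussianReal m v)) := by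
  set A : ℕ → ℝ → ℝ := fun k t => ∫ x, x ^ k * Real.exp (t * x) ∂(gaussianReal m v) with hA
  have hderiv (k : ℕ) (t : ℝ) : HasDerivAt (A k) (A (k + 1) t) t :=
    hasDerivAt_integral_pow_mul_exp_real (X := fun x => x) (by simp) k
  have hA0 : A 0 = fun t => Real.exp (m * t + v * t ^ 2 / 2) := by
    rw [← mgf_fun_id_gaussianReal]
    funext t
    simp [hA, mgf]
  have key : ∀ k t, A (k + 1) t = (m + v * t) * A k t + v * (k * A (k - 1) t) := by
    intro k
    induction k with
    | zero =>
      intro t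
      have h1 := hderiv 0 t
      have h2 : HasDerivAt (A 0) (Real.exp (m * t + v * t ^ 2 / 2) * (m * 1 + v * (2 * t) / 2)) t := by
        rw [hA0]
        refine HasDerivAt.exp (((hasDerivAt_id t).const_mul m).add ?_)
        have := ((hasDerivAt_pow 2 t).const_mul (v : ℝ)).div_const 2
        simpa using this
      rw [h1.unique h2, hA0]
      simp
      ring
    | succ k ih =>
      intro t
      have h1 := hderiv (k + 1) t
      have h2 : HasDerivAt (A (k + 1))
          (v * A k t + (m + v * t) * A (k + 1) t + v * (k * A (k - 1 + 1) t)) t := by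
        have h3 : HasDerivAt (fun t : ℝ => m + v * t) v t := by
          simpa using ((hasDerivAt_id t).const_mul (v : ℝ)).const_add m
        have := (h3.mul (hderiv k t)).add
          (((hderiv (k - 1) t).const_mul (k : ℝ)).const_mul (v : ℝ))
        exact this.congr_of_eventuallyEq (Eventually.of_forall ih)
      rw [h1.unique h2]
      rcases k with _ | k
      · simp
        ring
      · simp only [Nat.add_sub_cancel]
        push_cast
        ring
  simpa [hA] using key k 0

/-- Gaussian integration by parts for polynomials. -/
lemma integral_mul_eval_gaussianReal (m : ℝ) (v : NNReal) (p : Polynomial ℝ) :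
    ∫ x, x * p.eval x ∂(gaussianReal m v) =
      m * ∫ x, p.eval x ∂(gaussianReal m v) + v * ∫ x, p.derivative.eval x ∂(gaussianReal m v) := by
  have hfint (p : Polynomial ℝ) : Integrable (fun x => x * p.eval x) (gaussianReal m v) := by
    have h := integrable_eval_gaussianReal m v (Polynomial.X * p)
    simp only [Polynomial.eval_mul, Polynomial.eval_X] at h
    exact h
  induction p using Polynomial.induction_on' with
  | add p q hp hq =>
    simp only [Polynomial.eval_add, Polynomial.derivative_add, mul_add]
    rw [integral_add (hfint p) (hfint q), integral_add (integrable_eval_gaussianReal m v p)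
      (integrable_eval_gaussianReal m v q), integral_add (integrable_eval_gaussianReal m v _)
      (integrable_eval_gaussianReal m v _), hp, hq]
    ring
  | monomial k a =>
    have h1 : ∀ x : ℝ, x * (a * x ^ k) = a * x ^ (k + 1) := fun x => by ring
    simp only [Polynomial.eval_monomial, Polynomial.derivative_monomial, h1, integral_const_mul,
      integral_pow_gaussianReal_succ m v k]
    ring

/-- The mean of the Hermite polynomial of degree `k` under a shifted Gaussian law. -/
lemma integral_hermiteVar_gaussianReal (m : ℝ) (v : NNReal) (k : ℕ) :
    ∫ x, (hermiteVar v k).eval x ∂(gaussianReal m v) = m ^ k := by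
  induction k with
  | zero => simp [hermiteVar]
  | succ k ih =>
    simp only [hermiteVar_succ, Polynomial.eval_sub, Polynomial.eval_mul, Polynomial.eval_X,
      Polynomial.eval_C]
    rw [integral_sub, integral_mul_eval_gaussianReal, integral_const_mul, ih]
    · ring
    · have h := integrable_eval_gaussianReal m v (Polynomial.X * hermiteVar v k)
      simp only [Polynomial.eval_mul, Polynomial.eval_X] at h
      exact h
    · exact (integrable_eval_gaussianReal m v _).const_mul _

/-- The Wick isometry conditionally on an independent part w. Integration by parts moves the factor
x of the recursion onto the second polynomial, whose derivative is c(k + 1) times the one of degree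
k. The shift w and the parameter u drop out. -/
lemma integral_hermiteVar_mul_hermiteVar_comp (v : NNReal) (u c w : ℝ) (k : ℕ) :
    ∫ x, (hermiteVar v k).eval x * (hermiteVar u k).eval (c * x + w) ∂(gaussianReal 0 v) =
      k.factorial * (c * v) ^ k := by
  induction k with
  | zero => simp [hermiteVar]
  | succ k ih =>
    set q := (hermiteVar u (k + 1)).comp (Polynomial.C c * Polynomial.X + Polynomial.C w) with hq
    have hqe (x : ℝ) : (hermiteVar u (k + 1)).eval (c * x + w) = q.eval x := by simp [hq]
    have hqd (x : ℝ) : q.derivative.eval x = c * ((k + 1) * (hermiteVar u k).eval (c * x + w)) := by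
      rw [hq, Polynomial.derivative_comp, derivative_hermiteVar]
      simp
    have hst := integral_mul_eval_gaussianReal 0 v (hermiteVar v k * q)
    simp only [Polynomial.eval_mul, Polynomial.derivative_mul, Polynomial.eval_add, zero_mul,
      zero_add] at hst
    have i1 := integrable_eval_gaussianReal 0 v ((hermiteVar v k).derivative * q)
    have i2 := integrable_eval_gaussianReal 0 v ((hermiteVar v k) * q.derivative)
    have i3 := integrable_eval_gaussianReal 0 v (Polynomial.X * (hermiteVar v k * q))
    simp only [Polynomial.eval_mul, Polynomial.eval_X] at i1 i2 i3
    rw [integral_add i1 i2] at hst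
    have h1 : ∀ x, (hermiteVar v (k + 1)).eval x * q.eval x =
        x * ((hermiteVar v k).eval x * q.eval x) -
          v * ((hermiteVar v k).derivative.eval x * q.eval x) := by
      intro x
      simp only [hermiteVar_succ, Polynomial.eval_sub, Polynomial.eval_mul, Polynomial.eval_X,
        Polynomial.eval_C]
      ring
    simp_rw [hqe, h1]
    rw [integral_sub i3 (i1.const_mul _), hst, integral_const_mul]
    have h2 : ∀ x, (hermiteVar v k).eval x * q.derivative.eval x =
        (c * (k + 1)) * ((hermiteVar v k).eval x * (hermiteVar u k).eval (c * x + w)) := by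
      intro x
      rw [hqd]
      ring
    simp_rw [h2]
    rw [integral_const_mul, ih, Nat.factorial_succ]
    push_cast
    ring

/-- A moment generating function finite on all of ℝ continues analytically to ℂ and so determines
the characteristic function. Finite measures are needed since positive and negative parts of a
density are compared later. -/
lemma measure_eq_of_mgf_eq {μ ν : Measure ℝ} [IsFiniteMeasure μ] [IsFiniteMeasure ν]
    (h : mgf id μ = mgf id ν) (hμ : ∀ t, Integrable (fun x => Real.exp (t * x)) μ) : μ = ν := by
  have h0 : μ = 0 ↔ ν = 0 := by
    have := congrFun h 0
    simp only [mgf_zero'] at this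
    rw [← Measure.measure_univ_eq_zero, ← Measure.measure_univ_eq_zero,
      ← measureReal_eq_zero_iff, ← measureReal_eq_zero_iff, this]
  have hset : integrableExpSet id μ = Set.univ := by
    ext t
    simpa [integrableExpSet] using hμ t
  refine Measure.ext_of_complexMGF_id_eq (funext fun z => ?_)
  exact eqOn_complexMGF_of_mgf' h h0 (by simp [hset])

end GaussianHermite

/-! ### Calculus on the linear span of a Gaussian process -/

section GaussianSpan

variable {Ω T : Type*} [MeasurableSpace Ω] {P : Measure Ω} {B : T → Ω → ℝ}

/-- A measurable centred real Gaussian process. -/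
structure IsCentredGaussian (P : Measure Ω) (B : T → Ω → ℝ) : Prop where
  measurable : ∀ t, Measurable (B t)
  gaussian : IsGaussianProcess B P
  mean_zero : ∀ t, ∫ ω, B t ω ∂P = 0

/-- Both variables depend linearly on the process at one common finite set of times, so the pair is
a linear image of a Gaussian vector. -/
lemma IsCentredGaussian.hasGaussianLaw_prod (hB : IsCentredGaussian P B)
    {Φ Ψ : Ω → ℝ} (hΦ : Φ ∈ Submodule.span ℝ (Set.range B))
    (hΨ : Ψ ∈ Submodule.span ℝ (Set.range B)) : HasGaussianLaw (fun ω => (Φ ω, Ψ ω)) P := by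
  classical
  obtain ⟨c, rfl⟩ := Finsupp.mem_span_range_iff_exists_finsupp.1 hΦ
  obtain ⟨d, rfl⟩ := Finsupp.mem_span_range_iff_exists_finsupp.1 hΨ
  set I := c.support ∪ d.support with hI
  let ℓ (e : T →₀ ℝ) : (I → ℝ) →L[ℝ] ℝ := ∑ i : I, e i • ContinuousLinearMap.proj i
  have hℓ (e : T →₀ ℝ) (he : e.support ⊆ I) (ω : Ω) :
      ℓ e (I.restrict (fun t => B t ω)) = (e.sum fun t a => a • B t) ω := by
    rw [Finsupp.sum_of_support_subset _ he _ (by simp)]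
    simp only [ℓ, sum_apply, smul_apply,
      ContinuousLinearMap.proj_apply, Finset.restrict, smul_eq_mul, Finset.sum_apply, Pi.smul_apply]
    exact Finset.sum_coe_sort I fun t => e t * B t ω
  have h := (hB.gaussian.hasGaussianLaw I).map_fun ((ℓ c).prod (ℓ d))
  simp only [ContinuousLinearMap.prod_apply, hℓ c Finset.subset_union_left,
    hℓ d Finset.subset_union_right] at h
  exact h

lemma IsCentredGaussian.hasGaussianLaw (hB : IsCentredGaussian P B)
    {Φ : Ω → ℝ} (hΦ : Φ ∈ Submodule.span ℝ (Set.range B)) : HasGaussianLaw Φ P :=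
  (hB.hasGaussianLaw_prod hΦ hΦ).fst

lemma IsCentredGaussian.measurable_of_mem (hB : IsCentredGaussian P B)
    {Φ : Ω → ℝ} (hΦ : Φ ∈ Submodule.span ℝ (Set.range B)) : Measurable Φ := by
  induction hΦ using Submodule.span_induction with
  | mem x hx => obtain ⟨t, rfl⟩ := hx; exact hB.measurable t
  | zero => exact measurable_zero
  | add x y _ _ hx hy => exact hx.add hy
  | smul a x _ hx => exact hx.const_smul a

lemma IsCentredGaussian.integral_eq_zero (hB : IsCentredGaussian P B)
    {Φ : Ω → ℝ} (hΦ : Φ ∈ Submodule.span ℝ (Set.range B)) : ∫ ω, Φ ω ∂P = 0 := by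
  induction hΦ using Submodule.span_induction with
  | mem x hx => obtain ⟨t, rfl⟩ := hx; exact hB.mean_zero t
  | zero => simp
  | add x y hx hy h1 h2 =>
    simp only [Pi.add_apply]
    rw [integral_add (hB.hasGaussianLaw hx).integrable (hB.hasGaussianLaw hy).integrable, h1, h2,
      add_zero]
  | smul a x hx h =>
    simp only [Pi.smul_apply, smul_eq_mul]
    rw [integral_const_mul, h, mul_zero]

lemma IsCentredGaussian.map_eq (hB : IsCentredGaussian P B)
    {Φ : Ω → ℝ} (hΦ : Φ ∈ Submodule.span ℝ (Set.range B)) :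
    P.map Φ = gaussianReal 0 (∫ ω, Φ ω ^ 2 ∂P).toNNReal := by
  rw [(hB.hasGaussianLaw hΦ).map_eq_gaussianReal, hB.integral_eq_zero hΦ,
    variance_of_integral_eq_zero (hB.measurable_of_mem hΦ).aemeasurable (hB.integral_eq_zero hΦ)]

lemma coe_toNNReal_integral_sq (P : Measure Ω) (Φ : Ω → ℝ) :
    ((∫ ω, Φ ω ^ 2 ∂P).toNNReal : ℝ) = ∫ ω, Φ ω ^ 2 ∂P :=
  Real.coe_toNNReal _ (integral_nonneg fun _ => sq_nonneg _)

lemma IsCentredGaussian.integral_exp (hB : IsCentredGaussian P B)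
    {Φ : Ω → ℝ} (hΦ : Φ ∈ Submodule.span ℝ (Set.range B)) :
    ∫ ω, Real.exp (Φ ω) ∂P = Real.exp ((∫ ω, Φ ω ^ 2 ∂P) / 2) := by
  have h := mgf_gaussianReal (hB.map_eq hΦ) 1
  rw [coe_toNNReal_integral_sq] at h
  simpa [mgf] using h

lemma IsCentredGaussian.integrable_exp (hB : IsCentredGaussian P B)
    {Φ : Ω → ℝ} (hΦ : Φ ∈ Submodule.span ℝ (Set.range B)) :
    Integrable (fun ω => Real.exp (Φ ω)) P := by
  -- The Bochner integral of a non-integrable function is 0, so a nonzero value proves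
  -- integrability.
  refine Integrable.of_integral_ne_zero ?_
  rw [hB.integral_exp hΦ]
  exact (Real.exp_pos _).ne'

lemma IsCentredGaussian.integrable_mul (hB : IsCentredGaussian P B)
    {Φ Ψ : Ω → ℝ} (hΦ : Φ ∈ Submodule.span ℝ (Set.range B))
    (hΨ : Ψ ∈ Submodule.span ℝ (Set.range B)) : Integrable (fun ω => Φ ω * Ψ ω) P :=
  (hB.hasGaussianLaw hΦ).memLp_two.integrable_mul (hB.hasGaussianLaw hΨ).memLp_two

lemma IsCentredGaussian.integral_sq_smul_add (hB : IsCentredGaussian P B)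
    {Φ Ψ : Ω → ℝ} (hΦ : Φ ∈ Submodule.span ℝ (Set.range B))
    (hΨ : Ψ ∈ Submodule.span ℝ (Set.range B)) (a : ℝ) :
    ∫ ω, (a * Φ ω + Ψ ω) ^ 2 ∂P =
      a ^ 2 * ∫ ω, Φ ω ^ 2 ∂P + 2 * a * ∫ ω, Φ ω * Ψ ω ∂P + ∫ ω, Ψ ω ^ 2 ∂P := by
  have h1 : ∀ ω, (a * Φ ω + Ψ ω) ^ 2 =
      a ^ 2 * (Φ ω ^ 2) + 2 * a * (Φ ω * Ψ ω) + Ψ ω ^ 2 := fun ω => by ring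
  have i1 := hB.integrable_mul hΦ hΦ
  have i2 := hB.integrable_mul hΨ hΨ
  simp only [← sq] at i1 i2
  have i3 := hB.integrable_mul hΦ hΨ
  simp_rw [h1]
  have i4 : Integrable (fun ω => a ^ 2 * (Φ ω ^ 2) + 2 * a * (Φ ω * Ψ ω)) P :=
    (i1.const_mul _).add (i3.const_mul _)
  rw [integral_add i4 i2, integral_add (i1.const_mul _) (i3.const_mul _), integral_const_mul, integral_const_mul]

/-- Exhibits the Wick exponential as the density of `P.tilted Ψ`, so that the S-transform is an
expectation under the tilted measure. -/
lemma IsCentredGaussian.wickExp_eq (hB : IsCentredGaussian P B)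
    {Ψ : Ω → ℝ} (hΨ : Ψ ∈ Submodule.span ℝ (Set.range B)) (ω : Ω) :
    wickExp P Ψ ω = Real.exp (Ψ ω) / ∫ ω, Real.exp (Ψ ω) ∂P := by
  simp only [wickExp, sq_abs]
  rw [hB.integral_exp hΨ, Real.exp_sub]

/-- The Cameron–Martin formula for a single Gaussian variable. -/
lemma IsCentredGaussian.map_tilted_eq [IsProbabilityMeasure P]
    (hB : IsCentredGaussian P B) {Φ Ψ : Ω → ℝ}
    (hΦ : Φ ∈ Submodule.span ℝ (Set.range B)) (hΨ : Ψ ∈ Submodule.span ℝ (Set.range B)) :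
    (P.tilted Ψ).map Φ =
      gaussianReal (∫ ω, Φ ω * Ψ ω ∂P) (∫ ω, Φ ω ^ 2 ∂P).toNNReal := by
  have hΦm := hB.measurable_of_mem hΦ
  have : IsProbabilityMeasure (P.tilted Ψ) := isProbabilityMeasure_tilted (hB.integrable_exp hΨ)
  have : IsProbabilityMeasure ((P.tilted Ψ).map Φ) :=
    Measure.isProbabilityMeasure_map hΦm.aemeasurable
  symm
  refine measure_eq_of_mgf_eq ?_ integrable_exp_mul_gaussianReal
  funext a
  have hmem : (a • Φ + Ψ) ∈ Submodule.span ℝ (Set.range B) :=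
    Submodule.add_mem _ (Submodule.smul_mem _ _ hΦ) hΨ
  have h := hB.integral_exp hmem
  simp only [Pi.add_apply, Pi.smul_apply, smul_eq_mul] at h
  rw [mgf_id_gaussianReal, mgf_id_map hΦm.aemeasurable, mgf, integral_tilted]
  have h1 : ∀ ω, (Real.exp (Ψ ω) / ∫ x, Real.exp (Ψ x) ∂P) • Real.exp (a * Φ ω) =
      Real.exp (a * Φ ω + Ψ ω) * (∫ x, Real.exp (Ψ x) ∂P)⁻¹ := by
    intro ω
    rw [smul_eq_mul, Real.exp_add]
    ring
  simp_rw [h1]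
  rw [integral_mul_const, h, hB.integral_exp hΨ, hB.integral_sq_smul_add hΦ hΨ, ← Real.exp_neg,
    ← Real.exp_add, coe_toNNReal_integral_sq]
  congr 1
  ring

/-- The `S`-transform of a Hermite polynomial. -/
lemma IsCentredGaussian.integral_hermiteVar_mul_wickExp [IsProbabilityMeasure P]
    (hB : IsCentredGaussian P B)
    {Φ Ψ : Ω → ℝ} (hΦ : Φ ∈ Submodule.span ℝ (Set.range B))
    (hΨ : Ψ ∈ Submodule.span ℝ (Set.range B)) (k : ℕ) :
    ∫ ω, (hermiteVar (∫ ω, Φ ω ^ 2 ∂P) k).eval (Φ ω) * wickExp P Ψ ω ∂P =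
      (∫ ω, Φ ω * Ψ ω ∂P) ^ k := by
  have h1 : ∀ ω, (hermiteVar (∫ ω, Φ ω ^ 2 ∂P) k).eval (Φ ω) * wickExp P Ψ ω =
      (Real.exp (Ψ ω) / ∫ x, Real.exp (Ψ x) ∂P) • (hermiteVar (∫ ω, Φ ω ^ 2 ∂P) k).eval (Φ ω) := by
    intro ω
    rw [hB.wickExp_eq hΨ, smul_eq_mul, mul_comm]
  simp_rw [h1]
  rw [← integral_tilted, ← integral_hermiteVar_gaussianReal _ (∫ ω, Φ ω ^ 2 ∂P).toNNReal,
    coe_toNNReal_integral_sq, ← hB.map_tilted_eq hΦ hΨ,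
    integral_map (hB.measurable_of_mem hΦ).aemeasurable
      (Polynomial.continuous _).aestronglyMeasurable]

lemma IsCentredGaussian.memLp_two_eval (hB : IsCentredGaussian P B)
    {Φ : Ω → ℝ} (hΦ : Φ ∈ Submodule.span ℝ (Set.range B)) (p : Polynomial ℝ) :
    MemLp (fun ω => p.eval (Φ ω)) 2 P := by
  have h := memLp_two_eval_gaussianReal 0 (∫ ω, Φ ω ^ 2 ∂P).toNNReal p
  rw [← hB.map_eq hΦ] at h
  exact (memLp_map_measure_iff (Polynomial.continuous p).aestronglyMeasurable
    (hB.measurable_of_mem hΦ).aemeasurable).1 h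

/-- Hermite polynomials of jointly Gaussian variables satisfy the Wick isometry. -/
lemma IsCentredGaussian.integral_hermiteVar_mul_hermiteVar [IsProbabilityMeasure P]
    (hB : IsCentredGaussian P B)
    {Φ Ψ : Ω → ℝ} (hΦ : Φ ∈ Submodule.span ℝ (Set.range B))
    (hΨ : Ψ ∈ Submodule.span ℝ (Set.range B)) (k : ℕ) :
    ∫ ω, (hermiteVar (∫ ω, Φ ω ^ 2 ∂P) k).eval (Φ ω) *
        (hermiteVar (∫ ω, Ψ ω ^ 2 ∂P) k).eval (Ψ ω) ∂P =
      k.factorial * (∫ ω, Φ ω * Ψ ω ∂P) ^ k := by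
  set u := ∫ ω, Φ ω ^ 2 ∂P with hu
  set v := ∫ ω, Ψ ω ^ 2 ∂P with hv
  set ρ := ∫ ω, Φ ω * Ψ ω ∂P with hρ
  have hΦm := hB.measurable_of_mem hΦ
  have hΨm := hB.measurable_of_mem hΨ
  have iΨ := hB.integrable_mul hΨ hΨ
  have iΦΨ := hB.integrable_mul hΦ hΨ
  -- The regression coefficient of Φ on Ψ. If v = 0, then Ψ = 0 almost surely, hence ρ = 0.
  obtain ⟨c, hc⟩ : ∃ c, c * v = ρ := by
    by_cases hv0 : v = 0
    · have h0 : (fun ω => Ψ ω ^ 2) =ᵐ[P] 0 := by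
        refine (integral_eq_zero_iff_of_nonneg (fun ω => sq_nonneg _) ?_).1 hv0
        simpa only [sq] using iΨ
      refine ⟨0, ?_⟩
      rw [zero_mul, hρ, eq_comm]
      refine integral_eq_zero_of_ae ?_
      filter_upwards [h0] with ω hω
      have : Ψ ω = 0 := by simpa using hω
      simp [this]
    · exact ⟨ρ / v, div_mul_cancel₀ _ hv0⟩
  -- The regression residual is uncorrelated with Ψ, hence independent of it by joint Gaussianity.
  -- Fubini then reduces the claim to a one-dimensional integral whose value does not depend on W.
  set W : Ω → ℝ := Φ - c • Ψ with hW
  have hWmem : W ∈ Submodule.span ℝ (Set.range B) :=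
    Submodule.sub_mem _ hΦ (Submodule.smul_mem _ _ hΨ)
  have hWm := hB.measurable_of_mem hWmem
  have hcov : cov[W, Ψ; P] = 0 := by
    rw [covariance_eq_sub (hB.hasGaussianLaw hWmem).memLp_two (hB.hasGaussianLaw hΨ).memLp_two,
      hB.integral_eq_zero hΨ, mul_zero, sub_zero]
    have h1 : ∀ ω, (W * Ψ) ω = Φ ω * Ψ ω - c * (Ψ ω * Ψ ω) := by
      intro ω
      simp only [hW, Pi.mul_apply, Pi.sub_apply, Pi.smul_apply, smul_eq_mul]
      ring
    simp_rw [h1]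
    rw [integral_sub iΦΨ (iΨ.const_mul c), integral_const_mul, ← hρ, ← hc, hv]
    simp only [sq, sub_self]
  have hind : IndepFun W Ψ P :=
    (hB.hasGaussianLaw_prod hWmem hΨ).indepFun_of_covariance_eq_zero hcov
  have hmap := hind.map_prod_eq_prod_map_map hWm.aemeasurable hΨm.aemeasurable
  set F : ℝ × ℝ → ℝ := fun p => (hermiteVar v k).eval p.2 * (hermiteVar u k).eval (c * p.2 + p.1)
    with hF
  have hFc : Continuous F := by
    have h1 := (hermiteVar v k).continuous
    have h2 := (hermiteVar u k).continuous
    fun_prop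
  have hFW : ∀ ω, (hermiteVar u k).eval (Φ ω) * (hermiteVar v k).eval (Ψ ω) = F (W ω, Ψ ω) := by
    intro ω
    simp only [hF, hW, Pi.sub_apply, Pi.smul_apply, smul_eq_mul, add_sub_cancel]
    ring
  have hfint : Integrable F ((P.map W).prod (P.map Ψ)) := by
    rw [← hmap, integrable_map_measure hFc.aestronglyMeasurable
      (hWm.prodMk hΨm).aemeasurable]
    refine ((hB.memLp_two_eval hΦ (hermiteVar u k)).integrable_mul
      (hB.memLp_two_eval hΨ (hermiteVar v k))).congr (Eventually.of_forall fun ω => ?_)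
    exact hFW ω
  simp_rw [hFW]
  rw [← integral_map (φ := fun ω => (W ω, Ψ ω)) (hWm.prodMk hΨm).aemeasurable
    hFc.aestronglyMeasurable, hmap, integral_prod F hfint]
  have hinner : ∀ w, ∫ x, F (w, x) ∂(P.map Ψ) = k.factorial * ρ ^ k := by
    intro w
    have h := integral_hermiteVar_mul_hermiteVar_comp v.toNNReal u c w k
    rw [hB.map_eq hΨ]
    rw [hv, coe_toNNReal_integral_sq, ← hv, hc] at h
    exact h
  have : IsProbabilityMeasure (P.map W) := Measure.isProbabilityMeasure_map hWm.aemeasurable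
  simp [hinner]

end GaussianSpan

/-! ### Injectivity of the S-transform and identification of the Wick powers -/

section STransform

variable {Ω T : Type*} [MeasurableSpace Ω] {P : Measure Ω} {B : T → Ω → ℝ}

lemma iSup_comap_eq_comap_pi {Ω' : Type*} (B : T → Ω' → ℝ) :
    (⨆ t, MeasurableSpace.comap (B t) inferInstance) =
      MeasurableSpace.comap (fun ω t => B t ω) MeasurableSpace.pi := by
  rw [MeasurableSpace.pi, MeasurableSpace.comap_iSup]
  simp_rw [MeasurableSpace.comap_comp]
  rfl

/-- The Cramér–Wold principle. -/
lemma measure_map_eq_of_charFun {ι : Type*} [Fintype ι] {μ ν : Measure Ω} [IsFiniteMeasure μ]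
    [IsFiniteMeasure ν] {X : Ω → ι → ℝ} (hX : Measurable X)
    (h : ∀ L : StrongDual ℝ (ι → ℝ), μ.map (fun ω => L (X ω)) = ν.map (fun ω => L (X ω))) :
    μ.map X = ν.map X := by
  refine Measure.ext_of_charFunDual (funext fun L => ?_)
  rw [charFunDual_eq_charFun_map_one, charFunDual_eq_charFun_map_one,
    Measure.map_map L.continuous.measurable hX, Measure.map_map L.continuous.measurable hX]
  exact congrArg (fun μ => charFun μ 1) (h L)

lemma integrable_toNNReal_mul {Z f : Ω → ℝ} (hZ : AEStronglyMeasurable Z P)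
    (hf : Integrable (fun ω => Z ω * f ω) P) (hfm : AEStronglyMeasurable f P) :
    Integrable (fun ω => ((Z ω).toNNReal : ℝ) * f ω) P := by
  refine hf.mono ?_ (Eventually.of_forall fun ω => ?_)
  · exact (Measurable.aestronglyMeasurable (by fun_prop :
      Measurable fun x : ℝ => (x.toNNReal : ℝ))).comp_aemeasurable hZ.aemeasurable |>.mul hfm
  · rw [norm_mul, norm_mul]
    refine mul_le_mul_of_nonneg_right ?_ (norm_nonneg _)
    rw [Real.coe_toNNReal', Real.norm_of_nonneg (le_max_right _ _), Real.norm_eq_abs]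
    exact max_le (le_abs_self _) (abs_nonneg _)

lemma IsCentredGaussian.memLp_two_exp (hB : IsCentredGaussian P B) {Ψ : Ω → ℝ}
    (hΨ : Ψ ∈ Submodule.span ℝ (Set.range B)) : MemLp (fun ω => Real.exp (Ψ ω)) 2 P := by
  refine (memLp_two_iff_integrable_sq (hB.measurable_of_mem hΨ).exp.aestronglyMeasurable).2 ?_
  refine (hB.integrable_exp (Submodule.smul_mem _ 2 hΨ)).congr (Eventually.of_forall fun ω => ?_)
  simp only [Pi.smul_apply, smul_eq_mul]
  rw [← Real.exp_nat_mul]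
  norm_num

/-- The `S`-transform is injective on square-integrable functionals of a Gaussian process. -/
lemma IsCentredGaussian.ae_eq_zero_of_sTransform_eq_zero [IsProbabilityMeasure P]
    (hB : IsCentredGaussian P B)
    {Z : Ω → ℝ} (hZ : IsL2Functional P B Z)
    (h : ∀ Ψ ∈ Submodule.span ℝ (Set.range B), ∫ ω, Z ω * Real.exp (Ψ ω) ∂P = 0) :
    Z =ᵐ[P] 0 := by
  classical
  set X : Ω → T → ℝ := fun ω t => B t ω with hX
  have hXm : Measurable X := measurable_pi_lambda _ hB.measurable
  have hZm := hZ.2.aestronglyMeasurable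
  have hZi : Integrable Z P := hZ.2.integrable (by norm_num)
  have hexp2 {Ψ : Ω → ℝ} (hΨ : Ψ ∈ Submodule.span ℝ (Set.range B)) :
      MemLp (fun ω => Real.exp (Ψ ω)) 2 P := hB.memLp_two_exp hΨ
  have hexpm {Ψ : Ω → ℝ} (hΨ : Ψ ∈ Submodule.span ℝ (Set.range B)) :
      AEStronglyMeasurable (fun ω => Real.exp (Ψ ω)) P :=
    (hexp2 hΨ).aestronglyMeasurable
  have hZexp {Ψ : Ω → ℝ} (hΨ : Ψ ∈ Submodule.span ℝ (Set.range B)) :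
      Integrable (fun ω => Z ω * Real.exp (Ψ ω)) P := hZ.2.integrable_mul (hexp2 hΨ)
  -- The positive and negative parts of Z are the densities of two finite measures μ and ν. The aim
  -- is that these agree on σ(B).
  set p : Ω → NNReal := fun ω => (Z ω).toNNReal with hp
  set q : Ω → NNReal := fun ω => (-Z ω).toNNReal with hq
  have hpm : AEMeasurable p P := hZm.aemeasurable.real_toNNReal
  have hqm : AEMeasurable q P := hZm.aemeasurable.neg.real_toNNReal
  have hpq : ∀ ω, (p ω : ℝ) - q ω = Z ω := by
    intro ω
    simp only [hp, hq, Real.coe_toNNReal']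
    rcases le_total 0 (Z ω) with h | h
    · rw [max_eq_left h, max_eq_right (by linarith), sub_zero]
    · rw [max_eq_right h, max_eq_left (by linarith), zero_sub, neg_neg]
  have hpi {f : Ω → ℝ} (hf : Integrable (fun ω => Z ω * f ω) P) (hfm : AEStronglyMeasurable f P) :
      Integrable (fun ω => (p ω : ℝ) * f ω) P := integrable_toNNReal_mul hZm hf hfm
  have hqi {f : Ω → ℝ} (hf : Integrable (fun ω => Z ω * f ω) P) (hfm : AEStronglyMeasurable f P) :
      Integrable (fun ω => (q ω : ℝ) * f ω) P :=
    integrable_toNNReal_mul hZm.neg (by simpa using hf.neg) hfm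
  have hfin (Y : Ω → ℝ) (hY : Integrable Y P) :
      IsFiniteMeasure (P.withDensity fun ω => ((Y ω).toNNReal : ENNReal)) :=
    isFiniteMeasure_withDensity_ofReal hY.2
  set μ := P.withDensity fun ω => (p ω : ENNReal) with hμ
  set ν := P.withDensity fun ω => (q ω : ENNReal) with hν
  have : IsFiniteMeasure μ := hfin Z hZi
  have : IsFiniteMeasure ν := hfin (-Z) hZi.neg
  have hΨμν {Ψ : Ω → ℝ} (hΨ : Ψ ∈ Submodule.span ℝ (Set.range B)) : μ.map Ψ = ν.map Ψ := by
    have hΨm := hB.measurable_of_mem hΨ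
    have hsm (a : ℝ) : a • Ψ ∈ Submodule.span ℝ (Set.range B) := Submodule.smul_mem _ a hΨ
    -- The span contains every multiple aΨ, so the hypothesis says that the moment generating
    -- functions of Ψ under μ and ν coincide.
    refine measure_eq_of_mgf_eq ?_ ?_
    · funext a
      rw [mgf_id_map hΨm.aemeasurable, mgf_id_map hΨm.aemeasurable, mgf, mgf,
        integral_withDensity_eq_integral_smul₀ hpm, integral_withDensity_eq_integral_smul₀ hqm,
        ← sub_eq_zero]
      simp only [NNReal.smul_def, smul_eq_mul]
      have hs := h _ (hsm a)
      have e1 := hpi (hZexp (hsm a)) (hexpm (hsm a))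
      have e2 := hqi (hZexp (hsm a)) (hexpm (hsm a))
      simp only [Pi.smul_apply, smul_eq_mul] at hs e1 e2
      rw [← integral_sub e1 e2, ← hs]
      simp_rw [← sub_mul, hpq]
    · intro a
      rw [integrable_map_measure (by fun_prop) hΨm.aemeasurable,
        integrable_withDensity_iff_integrable_coe_smul₀ hpm]
      exact hpi (hZexp (hsm a)) (hexpm (hsm a))
  have hmap : μ.map X = ν.map X := by
    -- The law of the whole process is determined by its finite-dimensional laws, and those by
    -- linear functionals, which lie in the span.
    refine (isProjectiveLimit_map (P := μ) (X := B) hXm.aemeasurable).unique ?_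
    intro I
    have hIm : Measurable fun ω => I.restrict (fun t => B t ω) :=
      (Finset.measurable_restrict I).comp hXm
    rw [Measure.map_map (Finset.measurable_restrict I) hXm]
    refine (measure_map_eq_of_charFun hIm fun L => hΨμν ?_).symm
    have hL : (fun ω => L (I.restrict (fun t => B t ω))) = ∑ t : I, L (Pi.single t 1) • B t := by
      funext ω
      conv_lhs => rw [← Finset.univ_sum_single (I.restrict (fun t => B t ω)), map_sum]
      simp only [Finset.sum_apply, Pi.smul_apply, smul_eq_mul]
      refine Finset.sum_congr rfl fun t _ => ?_
      rw [← mul_one (I.restrict (fun t => B t ω) t), ← smul_eq_mul, Pi.single_smul', map_smul,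
        smul_eq_mul, mul_comm]
      rfl
    rw [hL]
    exact Submodule.sum_mem _ fun t _ => Submodule.smul_mem _ _
      (Submodule.subset_span (Set.mem_range_self _))
  have hm : (⨆ t, MeasurableSpace.comap (B t) inferInstance) ≤ (inferInstance : MeasurableSpace Ω) :=
    iSup_le fun t => (hB.measurable t).comap_le
  -- As Z is almost everywhere equal to a σ(B)-measurable function, it suffices that its integrals
  -- over events of σ(B), the preimages under X, vanish.
  refine ae_eq_of_forall_setIntegral_eq_of_sigmaFinite' hm (fun s _ _ => hZi.integrableOn)
    (fun s _ _ => integrableOn_zero) (fun s hs _ => ?_) hZ.1 aestronglyMeasurable_zero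
  simp only [Pi.zero_apply, integral_zero]
  rw [iSup_comap_eq_comap_pi] at hs
  obtain ⟨S, hS, rfl⟩ := hs
  have hsm : MeasurableSet (X ⁻¹' S) := hXm hS
  have hμν : μ (X ⁻¹' S) = ν (X ⁻¹' S) := by
    rw [← Measure.map_apply hXm hS, ← Measure.map_apply hXm hS, hmap]
  have hone : Integrable (fun ω => Z ω * (1 : ℝ)) P := by simpa using hZi
  have ip := hpi hone aestronglyMeasurable_const
  have iq := hqi hone aestronglyMeasurable_const
  simp only [mul_one] at ip iq
  have hval {r : Ω → NNReal} (hr : AEMeasurable r P) :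
      ∫ ω in X ⁻¹' S, (r ω : ℝ) ∂P = ((P.withDensity fun ω => (r ω : ENNReal)) (X ⁻¹' S)).toReal := by
    rw [withDensity_apply _ hsm, integral_eq_lintegral_of_nonneg_ae
      (Eventually.of_forall fun ω => NNReal.coe_nonneg _)
      hr.coe_nnreal_real.aestronglyMeasurable.restrict]
    simp
  change ∫ ω in X ⁻¹' S, Z ω ∂P = 0
  simp_rw [← hpq]
  rw [integral_sub ip.integrableOn iq.integrableOn, hval hpm, hval hqm, sub_eq_zero]
  exact congrArg ENNReal.toReal hμν

lemma IsCentredGaussian.isL2Functional_eval (hB : IsCentredGaussian P B) (t : T)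
    (p : Polynomial ℝ) : IsL2Functional P B (fun ω => p.eval (B t ω)) := by
  refine ⟨?_, hB.memLp_two_eval (Submodule.subset_span (Set.mem_range_self t)) p⟩
  have h1 : Measurable[⨆ t, MeasurableSpace.comap (B t) inferInstance] (B t) :=
    Measurable.mono (comap_measurable (B t))
      (le_iSup (fun t => MeasurableSpace.comap (B t) inferInstance) t) le_rfl
  exact (p.continuous.measurable.comp h1).stronglyMeasurable.aestronglyMeasurable

lemma IsL2Functional.congr {X Y : Ω → ℝ} (hX : IsL2Functional P B X) (h : X =ᵐ[P] Y) :
    IsL2Functional P B Y :=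
  ⟨hX.1.congr h, (memLp_congr_ae h).1 hX.2⟩

lemma IsCentredGaussian.isWickProduct_unique [IsProbabilityMeasure P] (hB : IsCentredGaussian P B)
    {X Y Z Z' : Ω → ℝ} (h : IsWickProduct P B X Y Z) (h' : IsWickProduct P B X Y Z') :
    Z =ᵐ[P] Z' := by
  rw [← sub_ae_eq_zero]
  refine hB.ae_eq_zero_of_sTransform_eq_zero
    ⟨h.2.2.1.1.sub h'.2.2.1.1, h.2.2.1.2.sub h'.2.2.1.2⟩ fun Ψ hΨ => ?_
  have hm : MemLp (wickExp P Ψ) 2 P := by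
    have h2 : wickExp P Ψ = fun ω => (∫ ω, Real.exp (Ψ ω) ∂P)⁻¹ * Real.exp (Ψ ω) := by
      funext ω
      rw [hB.wickExp_eq hΨ, div_eq_inv_mul]
    rw [h2]
    exact (hB.memLp_two_exp hΨ).const_mul _
  have e := (h.2.2.2 Ψ hΨ).trans (h'.2.2.2 Ψ hΨ).symm
  have i1 : Integrable (fun ω => Z ω * wickExp P Ψ ω) P := h.2.2.1.2.integrable_mul hm
  have i2 : Integrable (fun ω => Z' ω * wickExp P Ψ ω) P := h'.2.2.1.2.integrable_mul hm
  rw [← sub_eq_zero, ← integral_sub i1 i2] at e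
  have hc : (∫ ω, Real.exp (Ψ ω) ∂P) ≠ 0 := by
    rw [hB.integral_exp hΨ]
    exact (Real.exp_pos _).ne'
  have h3 : ∀ ω, Z ω * wickExp P Ψ ω - Z' ω * wickExp P Ψ ω =
      (Z ω - Z' ω) * Real.exp (Ψ ω) * (∫ ω, Real.exp (Ψ ω) ∂P)⁻¹ := by
    intro ω
    rw [hB.wickExp_eq hΨ]
    ring
  simp_rw [h3] at e
  rw [integral_mul_const] at e
  simpa [hc] using e

/-- The Wick powers of a Gaussian variable are its Hermite polynomials. -/
lemma IsCentredGaussian.wickPow_ae_eq [IsProbabilityMeasure P] (hB : IsCentredGaussian P B) (t : T)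
    (k : ℕ) : wickPow P B (B t) k =ᵐ[P]
      fun ω => (hermiteVar (∫ ω, B t ω ^ 2 ∂P) k).eval (B t ω) := by
  have ht : B t ∈ Submodule.span ℝ (Set.range B) := Submodule.subset_span (Set.mem_range_self t)
  have h1 : B t = fun ω => (hermiteVar (∫ ω, B t ω ^ 2 ∂P) 1).eval (B t ω) := by
    simp [hermiteVar_one]
  match k with
  | 0 => simp [wickPow, hermiteVar]
  | 1 =>
    rw [wickPow, ← h1]
  | k + 2 =>
    have ih := hB.wickPow_ae_eq t (k + 1)
    -- On S-transforms the claim reads E[BΨ]^(k+2) = E[BΨ]^(k+1) · E[BΨ].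
    have hW : IsWickProduct P B (wickPow P B (B t) (k + 1)) (B t)
        (fun ω => (hermiteVar (∫ ω, B t ω ^ 2 ∂P) (k + 2)).eval (B t ω)) := by
      refine ⟨(hB.isL2Functional_eval t _).congr ih.symm, h1 ▸ hB.isL2Functional_eval t _,
        hB.isL2Functional_eval t _, fun Ψ hΨ => ?_⟩
      rw [hB.integral_hermiteVar_mul_wickExp ht hΨ]
      have e1 : ∫ ω, wickPow P B (B t) (k + 1) ω * wickExp P Ψ ω ∂P =
          (∫ ω, B t ω * Ψ ω ∂P) ^ (k + 1) := by
        rw [← hB.integral_hermiteVar_mul_wickExp ht hΨ]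
        refine integral_congr_ae ?_
        filter_upwards [ih] with ω hω
        rw [hω]
      have e2 := hB.integral_hermiteVar_mul_wickExp ht hΨ 1
      simp only [hermiteVar_one, Polynomial.eval_X, pow_one] at e2
      rw [e1, e2, pow_succ]
    -- Existence rules out the default value 0 in `wick`; uniqueness identifies the chosen version
    -- almost surely.
    have hex : ∃ Z, IsWickProduct P B (wickPow P B (B t) (k + 1)) (B t) Z := ⟨_, hW⟩
    rw [wickPow, wick, dif_pos hex]
    exact hB.isWickProduct_unique hex.choose_spec hW

lemma IsCentredGaussian.integral_wickPow_sub_sq [IsProbabilityMeasure P]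
    (hB : IsCentredGaussian P B) (s t : T) (k : ℕ) :
    ∫ ω, (wickPow P B (B t) k ω - wickPow P B (B s) k ω) ^ 2 ∂P =
      k.factorial * ((∫ ω, B t ω * B t ω ∂P) ^ k + (∫ ω, B s ω * B s ω ∂P) ^ k
        - 2 * (∫ ω, B t ω * B s ω ∂P) ^ k) := by
  have ht : B t ∈ Submodule.span ℝ (Set.range B) := Submodule.subset_span (Set.mem_range_self t)
  have hs : B s ∈ Submodule.span ℝ (Set.range B) := Submodule.subset_span (Set.mem_range_self s)
  have h1 : (fun ω => (wickPow P B (B t) k ω - wickPow P B (B s) k ω) ^ 2) =ᵐ[P] fun ω =>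
      (hermiteVar (∫ ω, B t ω ^ 2 ∂P) k).eval (B t ω) *
        (hermiteVar (∫ ω, B t ω ^ 2 ∂P) k).eval (B t ω) +
      (hermiteVar (∫ ω, B s ω ^ 2 ∂P) k).eval (B s ω) *
        (hermiteVar (∫ ω, B s ω ^ 2 ∂P) k).eval (B s ω) -
      2 * ((hermiteVar (∫ ω, B t ω ^ 2 ∂P) k).eval (B t ω) *
        (hermiteVar (∫ ω, B s ω ^ 2 ∂P) k).eval (B s ω)) := by
    filter_upwards [hB.wickPow_ae_eq t k, hB.wickPow_ae_eq s k] with ω h1 h2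
    rw [h1, h2]
    ring
  have mt := hB.memLp_two_eval ht (hermiteVar (∫ ω, B t ω ^ 2 ∂P) k)
  have ms := hB.memLp_two_eval hs (hermiteVar (∫ ω, B s ω ^ 2 ∂P) k)
  set X := fun ω => (hermiteVar (∫ ω, B t ω ^ 2 ∂P) k).eval (B t ω) with hX
  set Y := fun ω => (hermiteVar (∫ ω, B s ω ^ 2 ∂P) k).eval (B s ω) with hY
  have itt : Integrable (fun ω => X ω * X ω) P := mt.integrable_mul mt
  have iss : Integrable (fun ω => Y ω * Y ω) P := ms.integrable_mul ms
  have its : Integrable (fun ω => X ω * Y ω) P := mt.integrable_mul ms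
  have iadd : Integrable (fun ω => X ω * X ω + Y ω * Y ω) P := itt.add iss
  rw [integral_congr_ae h1]
  change ∫ ω, (X ω * X ω + Y ω * Y ω - 2 * (X ω * Y ω)) ∂P = _
  rw [integral_sub iadd (its.const_mul 2), integral_add itt iss, integral_const_mul, hB.integral_hermiteVar_mul_hermiteVar ht ht,
    hB.integral_hermiteVar_mul_hermiteVar hs hs, hB.integral_hermiteVar_mul_hermiteVar ht hs]
  ring

lemma IsFBM.isCentredGaussian {H : ℝ} {B : unitInterval → Ω → ℝ} (hB : IsFBM P H B) :
    IsCentredGaussian P B :=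
  ⟨hB.measurable, hB.gaussian, hB.mean_zero⟩

end STransform

end WickFBM

end

theorem proposition4p3 {Ω : Type*} [MeasurableSpace Ω] (P : Measure Ω) [IsProbabilityMeasure P]
    (H : ℝ) (hH : 1 / 2 < H) (hH' : H < 1)
    (ξ : (n : ℕ) → Fin n → Ω → ℝ) (hξ : WickFBM.IsBernoulliArray P ξ) :
    (∀ (n N : ℕ) (s t : unitInterval), 1 ≤ n → s ≤ t → N ≤ ⌊(n : ℝ) * (s : ℝ)⌋₊ →
      (∫ ω, (WickFBM.disturbedWalk H (ξ n) t ω) ^ 2 ∂P) ^ N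
          + (∫ ω, (WickFBM.disturbedWalk H (ξ n) s ω) ^ 2 ∂P) ^ N
          - 2 * (∫ ω, WickFBM.disturbedWalk H (ξ n) t ω *
              WickFBM.disturbedWalk H (ξ n) s ω ∂P) ^ N
          - 1 / (N.factorial : ℝ) *
            ∫ ω, (WickFBM.discreteWickPow P (ξ n) (WickFBM.disturbedWalk H (ξ n) t) N ω
              - WickFBM.discreteWickPow P (ξ n) (WickFBM.disturbedWalk H (ξ n) s) N ω) ^ 2 ∂P
        ∈ Set.Icc 0 (2 * WickFBM.cH H ^ 2 * (N : ℝ) ^ 2 * (t : ℝ) ^ (2 * H * ((N : ℝ) - 1)) *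
            (n : ℝ) ^ (-(2 - 2 * H)))) ∧
    (∀ {Ω' : Type*} [MeasurableSpace Ω'] (P' : Measure Ω') [IsProbabilityMeasure P']
      (B : unitInterval → Ω' → ℝ), WickFBM.IsFBM P' H B →
      ∀ (N : ℕ) (s t : unitInterval), s ≤ t →
        Tendsto (fun n : ℕ =>
            ∫ ω, (WickFBM.discreteWickPow P (ξ n) (WickFBM.disturbedWalk H (ξ n) t) N ω
              - WickFBM.discreteWickPow P (ξ n) (WickFBM.disturbedWalk H (ξ n) s) N ω) ^ 2 ∂P)
          atTop
          (𝓝 (∫ ω, (WickFBM.wickPow P' B (B t) N ω - WickFBM.wickPow P' B (B s) N ω) ^ 2 ∂P'))) := by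
  refine ⟨fun n N s t hn hst _ =>
    WickFBM.wickPow_defect_mem_Icc hξ hH hH' hn N s.2.1 hst t.2.2, ?_⟩
  intro Ω' _ P' _ B hB N s t hst
  have hst' : (0 : ℝ) ≤ (t : ℝ) - s := sub_nonneg.2 hst
  have hcov (r : unitInterval) : ∫ ω, B r ω * B r ω ∂P' = (r : ℝ) ^ (2 * H) := by
    rw [hB.covariance, sub_self, abs_zero, Real.zero_rpow (by linarith), sub_zero,
      add_self_div_two]
  -- The Gaussian second moment becomes the explicit expression already found as the limit of the
  -- discrete ones.
  rw [hB.isCentredGaussian.integral_wickPow_sub_sq s t N, hcov, hcov, hB.covariance s t,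
    abs_of_nonneg hst']
  exact WickFBM.tendsto_integral_discreteWickPow_sub_sq hξ hH hH' N s.2.1 hst t.2.2
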